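/- \textbf{Setting.} Let $\mathbb N^*=\{0,0^*,1,1^*,\dots\}$ with $0<0^*<1<1^*<\cdots$ ($^*$ is the tie-breaking advantage), $[k]=\{0,0^*,\dots,k,k^*\}$, and let $|m|=|m^*|=m$. A \emph{frugal-parity discrete-bidding game} $\mathcal G=\langle V,E,k,p,S,\mathtt{fr}\rangle$ consists of a finite non-empty directed graph $(V,E)$, a total budget $k\in\mathbb N$, sinks $S\subseteq V$ (every $v\notin S$ has a neighbour; $N(v)$ is the set of neighbours), frugal target budgets $\mathtt{fr}:S\to[k]\cup\{k+1\}$, and parity indices $p:V\setminus S\to\{0,\dots,d\}$. A configuration is $\langle v,B\rangle$, $B\in[k]$ being Player 1's budget; Player 2's budget is $k^*\ominus B$. In each turn both players simultaneously choose a legal bid and a neighbour of the current vertex; the higher bidder moves the token to his choice and pays his bid to the other player. A player who has the advantage may include it in his bid; on a tie the player with the advantage (who did not use it) loses the bidding and keeps the advantage. Player 1 wins a play iff it ends in a sink $s$ with $B\ge\mathtt{fr}(s)$, or it never reaches $S$ and the largest parity index visited infinitely often is odd. A function $T:V\to[k]\cup\{k+1\}$ gives the \emph{threshold budgets} $\mathtt{Th}_{\mathcal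 G}$ if, for all $v\in V$ and $B\in[k]$, Player 1 has a winning strategy from $\langle v,B\rangle$ when $B\ge T(v)$, and Player 2 has one when $B<T(v)$. It has the \emph{average property} if $T=\mathtt{fr}$ on $S$ and, for $v\notin S$, with $T(v^+)=\max_{N(v)}T$, $T(v^-)=\min_{N(v)}T$ and $\sigma=|T(v^+)|+|T(v^-)|$, we have $T(v)=\lfloor \sigma/2\rfloor+\varepsilon$, where $\varepsilon=0$ if $\sigma$ is even and $T(v^-)\in\mathbb N$, $\varepsilon=1$ if $\sigma$ is odd and $T(v^-)\notin\mathbb N$, and $\varepsilon={}^*$ otherwise. \textbf{Algorithm.} \textsc{Frugal-Reachability} starts from $\mathtt{fr}$ on the sinks and $k+1$ elsewhere, and replaces simultaneously the value at each non-sink by the average above until nothing changes; \textsc{Frugal-Safety} is its dual and starts from $0$ instead of $k+1$. \textsc{Frugal-Parity-Threshold}$(\mathcal G)$: if at most one parity index is in use, call \textsc{Frugal-Safety} if it is odd and \textsc{Frugal-Reachability} otherwise. Otherwise let $m$ be the largest parity index in use and $F=\{v\notin S: p(v)=m\}$. For $i=0,1,\dots$, compute recursively the output $\mathtt{Th}_{\mathcal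 G_i}$ for the game $\mathcal G_i$ obtained from $\mathcal G$ by turning $F$ into sinks with frugal target budgets $\mathtt{fr}_i$, where $\mathtt{fr}_0\equiv k+1$ if $m$ is even and $\mathtt{fr}_0\equiv 0$ if $m$ is odd; then compute $\mathtt{fr}_{i+1}:=\mathtt{Th}_{\mathcal R_i}|_{F}$ by \textsc{Frugal-Reachability} ($m$ even) or \textsc{Frugal-Safety} ($m$ odd) on the game $\mathcal R_i$ in which all vertices outside $F$ are sinks, with frugal target budgets $\mathtt{fr}$ on $S$ and $\mathtt{Th}_{\mathcal G_i}$ elsewhere. At the first $i\ge 1$ with $\mathtt{fr}_i=\mathtt{fr}_{i+1}$ on $F$, output $\mathtt{fr}_i$ on $F$ and $\mathtt{Th}_{\mathcal G_i}$ on $V\setminus F$. Running time is counted in passes over the game graph (one round of value iteration, the construction of one subgame, one comparison of two budget functions), each of which takes $O(|V|+|E|)$ operations on budgets. \textbf{Theorem.} For every frugal-parity discrete-bidding game $\mathcal G$ with parity indices at most $d$, \textsc{Frugal-Parity-Threshold}$(\mathcal G)$ terminates and outputs the threshold budgets $\mathtt{Th}_{\mathcal G}$; in particular they exist. Moreover,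 $\mathtt{Th}_{\mathcal G}$ satisfies the average property. If $k\ge1$, the running time is $O\big((|V|\cdot k)^d\big)$ when the parity indices lie in $\{1,\dots,d\}$, and $O\big((|V|\cdot k)^{d+1}\big)$ when index $0$ is allowed as well, with absolute constants. -/

import Mathlib

namespace DiscreteBidding

/-! ## Budgets

A budget is an element of `ℕ* = {0, 0*, 1, 1*, 2, 2*, …}`, where `*` is the advantage. It is
represented by its position in the order `0 < 0* < 1 < 1* < ⋯`: `n` is `2 * n` and `n*` is
`2 * n + 1`. The order of `ℕ*` is thus the order of the codes, `x ⊕ y` and `x ⊖ y`, wherever they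
are defined, are addition and subtraction of codes, and successor and predecessor are `± 1`. -/

/-- Elements of `ℕ*`, as codes. -/
abbrev Budget := ℕ

/-- The budget `n`, without the advantage. -/
def plain (n : ℕ) : Budget := 2 * n

/-- The budget `n*`, with the advantage. -/
def starred (n : ℕ) : Budget := 2 * n + 1

/-- The integer part `|B|`. -/
def intPart (B : Budget) : ℕ := B / 2

/-- `B ∈ ℕ* \ ℕ`: the budget contains the advantage. -/
def HasAdv (B : Budget) : Prop := B % 2 = 1

instance (B : Budget) : Decidable (HasAdv B) := inferInstanceAs (Decidable (B % 2 = 1))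

/-- The (discrete) average of the largest neighbouring value `hi` and the smallest one `lo`:
`⌊(|hi| + |lo|) / 2⌋ + ε`, with `ε` one of `0`, `1`, `*`. -/
def average (hi lo : Budget) : Budget :=
  let s := intPart hi + intPart lo
  if Even s ∧ ¬ HasAdv lo then plain (s / 2)
  else if Odd s ∧ HasAdv lo then plain (s / 2 + 1)
  else starred (s / 2)

/-! ## Games -/

/-- The data of a frugal-reachability or frugal-safety game: vertices `V`, edges `E`, total budget
`k`, sinks `S`, frugal target budgets `fr` (only its values on `S` matter). Every vertex that is
not a sink has a neighbour. -/
structure FrugalGame (V : Type*) [Fintype V] [DecidableEq V] where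
  k : ℕ
  E : Finset (V × V)
  S : Finset V
  fr : V → Budget
  exists_edge : ∀ v, v ∉ S → ∃ u, (v, u) ∈ E

/-- A frugal-parity game; only the values of the parity index `p` outside of `S` matter. -/
structure FrugalParityGame (V : Type*) [Fintype V] [DecidableEq V] extends FrugalGame V where
  p : V → ℕ

section Semantics

variable {V : Type*} [Fintype V] [DecidableEq V]

/-- The neighbours `N(v)`. -/
def FrugalGame.nbrs (G : FrugalGame V) (v : V) : Finset V :=
  Finset.univ.filter fun u => (v, u) ∈ G.E

theorem FrugalGame.nbrs_nonempty (G : FrugalGame V) {v : V} (hv : v ∉ G.S) :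
    (G.nbrs v).Nonempty := by
  obtain ⟨u, hu⟩ := G.exists_edge v hv
  exact ⟨u, by simp [FrugalGame.nbrs, hu]⟩

/-- The average of the values of `T` at the neighbours `v⁺` and `v⁻` of `v` at which `T` is
largest and smallest. -/
def FrugalGame.averageAt (G : FrugalGame V) (T : V → Budget) (v : V) (hv : v ∉ G.S) : Budget :=
  average ((G.nbrs v).sup' (G.nbrs_nonempty hv) T) ((G.nbrs v).inf' (G.nbrs_nonempty hv) T)

/-- The average property of a function `T : V → [k] ∪ {k + 1}`. -/
def FrugalGame.AverageProperty (G : FrugalGame V) (T : V → Budget) : Prop :=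
  (∀ v, T v ≤ plain (G.k + 1)) ∧
  (∀ s ∈ G.S, T s = G.fr s) ∧
  (∀ v (hv : v ∉ G.S), T v = G.averageAt T v hv)

/-- A configuration: the position of the token and Player 1's budget. -/
abbrev Config (V : Type*) := V × Budget

/-- An action: a bid, and the vertex to move to upon winning the bidding. -/
abbrev Action (V : Type*) := Budget × V

/-- The part of a history before the current configuration. -/
abbrev History (V : Type*) := List (Config V × Action V × Action V)

/-- Player 2's budget `k* ⊖ B`, when Player 1 has budget `B`. -/
def FrugalGame.budget₂ (G : FrugalGame V) (B : Budget) : Budget := starred G.k - B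

/-- The bids that are legal for a player with budget `B`: those that do not exceed it, and only a
player who has the advantage may use it. -/
def LegalBid (B b : Budget) : Prop := b ≤ B ∧ (HasAdv b → HasAdv B)

/-- One turn. On a tie the player who has the advantage chose not to use it: the other player wins
the bidding, and the advantage does not change hands. -/
def stepConfig (c : Config V) (a₁ a₂ : Action V) : Config V :=
  if a₂.1 < a₁.1 ∨ (a₁.1 = a₂.1 ∧ ¬ HasAdv c.2) then (a₁.2, c.2 - a₁.1)
  else (a₂.2, c.2 + a₂.1)

/-- The (legal) strategies of Player 1. -/
structure Strategy₁ (G : FrugalGame V) where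
  act : History V → Config V → Action V
  legal : ∀ h (c : Config V), c.1 ∉ G.S → c.2 ≤ starred G.k →
    LegalBid c.2 (act h c).1 ∧ (act h c).2 ∈ G.nbrs c.1

/-- The (legal) strategies of Player 2. -/
structure Strategy₂ (G : FrugalGame V) where
  act : History V → Config V → Action V
  legal : ∀ h (c : Config V), c.1 ∉ G.S → c.2 ≤ starred G.k →
    LegalBid (G.budget₂ c.2) (act h c).1 ∧ (act h c).2 ∈ G.nbrs c.1

/-- The history and the configuration after `n` turns. The game ends at a sink: from then on the
configuration is repeated. -/
def FrugalGame.run (G : FrugalGame V) (f : Strategy₁ G) (g : Strategy₂ G) (c : Config V) :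
    ℕ → History V × Config V
  | 0 => ([], c)
  | n + 1 =>
    let q := G.run f g c n
    if q.2.1 ∈ G.S then q
    else
      let a₁ := f.act q.1 q.2
      let a₂ := g.act q.1 q.2
      (q.1 ++ [(q.2, a₁, a₂)], stepConfig q.2 a₁ a₂)

/-- The sequence of configurations of a play. -/
def FrugalGame.play (G : FrugalGame V) (f : Strategy₁ G) (g : Strategy₂ G) (c : Config V) (n : ℕ) :
    Config V := (G.run f g c n).2

/-- The vertices that occur infinitely often. -/
def infVisited (π : ℕ → Config V) : Set V := {v | ∃ᶠ n in Filter.atTop, (π n).1 = v}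

/-- The frugal-parity objective: the play ends in a sink with at least the frugal target budget, or
it never reaches a sink and the largest parity index seen infinitely often is odd. -/
def FrugalParityGame.Objective (G : FrugalParityGame V) (π : ℕ → Config V) : Prop :=
  (∃ n, (π n).1 ∈ G.S ∧ G.fr (π n).1 ≤ (π n).2) ∨
  ((∀ n, (π n).1 ∉ G.S) ∧
    ∃ v ∈ infVisited π, Odd (G.p v) ∧ ∀ u ∈ infVisited π, G.p u ≤ G.p v)

/-- Player 1 has a winning strategy from the configuration `c`. -/
def FrugalParityGame.Wins₁ (G : FrugalParityGame V) (c : Config V) : Prop :=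
  ∃ f : Strategy₁ G.toFrugalGame, ∀ g : Strategy₂ G.toFrugalGame, G.Objective (G.play f g c)

/-- Player 2 has a winning strategy from the configuration `c`. -/
def FrugalParityGame.Wins₂ (G : FrugalParityGame V) (c : Config V) : Prop :=
  ∃ g : Strategy₂ G.toFrugalGame, ∀ f : Strategy₁ G.toFrugalGame, ¬ G.Objective (G.play f g c)

/-- `T : V → [k] ∪ {k + 1}` assigns to each vertex its threshold budget. -/
def FrugalParityGame.IsThreshold (G : FrugalParityGame V) (T : V → Budget) : Prop :=
  ∀ v, T v ≤ plain (G.k + 1) ∧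
    ∀ B ≤ starred G.k, (T v ≤ B → G.Wins₁ (v, B)) ∧ (B < T v → G.Wins₂ (v, B))

end Semantics

/-! ## The algorithm

A program may diverge, and it counts the time that it takes. The unit of time is one pass over the
game graph, i.e. a bounded number of elementary operations per vertex and per edge. -/

/-- Programs: possibly undefined (diverging) computations of a result and a running time. -/
structure Prog (α : Type*) where
  outcome : Part (α × ℕ)

/-- The program `m` halts with result `a` after `t` units of time. -/
def Prog.HaltsWith {α : Type*} (m : Prog α) (a : α) (t : ℕ) : Prop := (a, t) ∈ m.outcome

instance : Monad Prog where
  pure a := ⟨Part.some (a, 0)⟩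
  bind m f := ⟨m.outcome.bind fun x => (f x.1).outcome.map fun y => (y.1, x.2 + y.2)⟩

/-- Spend one unit of time. -/
def tick : Prog PUnit := ⟨Part.some (PUnit.unit, 1)⟩

/-- One round of a loop, from a state and the time that has passed so far. -/
def Prog.round {σ β : Type*} (body : σ → Prog (β ⊕ σ)) : σ × ℕ →. (β × ℕ) ⊕ (σ × ℕ) :=
  fun x => (body x.1).outcome.map fun y =>
    y.1.map (fun b => (b, x.2 + y.2)) (fun s => (s, x.2 + y.2))

/-- Repeat `body`, starting in the state `s`: a result `Sum.inr s'` is the next state, a result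
`Sum.inl b` ends the loop with `b`. The running times of the rounds are added up. -/
def Prog.loop {σ β : Type*} (body : σ → Prog (β ⊕ σ)) (s : σ) : Prog β :=
  ⟨(Prog.round body).fix (s, 0)⟩

section Algorithm

variable {V : Type*} [Fintype V] [DecidableEq V]

/-- One round of value iteration: replace the value at each non-sink vertex by the average. -/
def FrugalGame.sweep (G : FrugalGame V) (T : V → Budget) : V → Budget :=
  fun v => if hv : v ∈ G.S then G.fr v else G.averageAt T v hv

/-- Value iteration: rounds are repeated until nothing changes. Each round takes one unit. -/
def FrugalGame.iterate (G : FrugalGame V) (T : V → Budget) : Prog (V → Budget) :=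
  Prog.loop (fun T => do
    tick
    let T' := G.sweep T
    if T' = T then return Sum.inl T else return Sum.inr T') T

/-- The frugal target budgets on the sinks, and the value `x` at all other vertices. -/
def FrugalGame.initial (G : FrugalGame V) (x : Budget) : V → Budget :=
  fun v => if v ∈ G.S then G.fr v else x

/-- The sub-routine for frugal-reachability games: value iteration from `k + 1`. -/
def FrugalGame.frugalReachability (G : FrugalGame V) : Prog (V → Budget) := do
  tick
  G.iterate (G.initial (plain (G.k + 1)))

/-- The sub-routine for frugal-safety games, dual to the one for frugal-reachability games:
exchanging the players turns Player 1's threshold `k + 1` into `0`. -/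
def FrugalGame.frugalSafety (G : FrugalGame V) : Prog (V → Budget) := do
  tick
  G.iterate (G.initial 0)

/-- The parity indices in use. -/
def FrugalParityGame.indices (G : FrugalParityGame V) : Finset ℕ := G.Sᶜ.image G.p

/-- The maximal parity index `d` in use. -/
def FrugalParityGame.maxIndex (G : FrugalParityGame V) : ℕ := G.indices.sup id

/-- `F_d`: the vertices with the maximal parity index. -/
def FrugalParityGame.top (G : FrugalParityGame V) : Finset V :=
  G.Sᶜ.filter fun v => G.p v = G.maxIndex

/-- The frugal-parity game `G_i`: the vertices in `F_d` become sinks, with frugal target budgets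
`f`. -/
def FrugalParityGame.subParity (G : FrugalParityGame V) (f : V → Budget) :
    FrugalParityGame V where
  k := G.k
  E := G.E.filter fun e => e.1 ∉ G.top
  S := G.S ∪ G.top
  fr := fun v => if v ∈ G.S then G.fr v else f v
  exists_edge := by
    intro v hv
    rw [Finset.notMem_union] at hv
    obtain ⟨u, hu⟩ := G.exists_edge v hv.1
    exact ⟨u, by simp [hu, hv.2]⟩
  p := G.p

/-- The frugal-reachability (`d` even) or frugal-safety (`d` odd) game `R_i`: all vertices outside
of `F_d` become sinks, with frugal target budgets `f` outside of `S`. -/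
def FrugalParityGame.subTop (G : FrugalParityGame V) (f : V → Budget) : FrugalGame V where
  k := G.k
  E := G.E.filter fun e => e.1 ∈ G.top
  S := G.topᶜ
  fr := fun v => if v ∈ G.S then G.fr v else f v
  exists_edge := by
    intro v hv
    rw [Finset.mem_compl, not_not] at hv
    have hS : v ∉ G.S := by
      have := (Finset.mem_filter.mp hv).1
      rwa [Finset.mem_compl] at this
    obtain ⟨u, hu⟩ := G.exists_edge v hS
    exact ⟨u, by simp [hu, hv]⟩

theorem FrugalParityGame.card_indices_subParity_lt (G : FrugalParityGame V)
    (h : ¬ G.indices.card ≤ 1) (f : V → Budget) :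
    (G.subParity f).indices.card < G.indices.card := by
  apply Finset.card_lt_card
  rw [Finset.ssubset_iff_of_subset]
  · have hne : G.indices.Nonempty := by
      rw [← Finset.card_pos]; omega
    obtain ⟨m, hm, hmax⟩ := Finset.exists_mem_eq_sup G.indices hne id
    refine ⟨m, hm, ?_⟩
    intro hm'
    simp only [FrugalParityGame.indices, FrugalParityGame.subParity, Finset.mem_image,
      Finset.mem_compl, Finset.mem_union, not_or] at hm'
    obtain ⟨v, ⟨hvS, hvt⟩, hv⟩ := hm'
    apply hvt
    simp only [FrugalParityGame.top, Finset.mem_filter, Finset.mem_compl]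
    exact ⟨hvS, by rw [hv]; exact hmax.symm⟩
  · apply Finset.image_subset_image
    intro v hv
    simp only [FrugalParityGame.subParity, Finset.mem_compl, Finset.mem_union, not_or] at hv ⊢
    exact hv.1

/-- Solve the game `R_i`, whose frugal target budgets are the thresholds of `G_i`. -/
def FrugalParityGame.solveTop (G : FrugalParityGame V) (thG : V → Budget) : Prog (V → Budget) := do
  tick
  if Odd G.maxIndex then (G.subTop thG).frugalSafety else (G.subTop thG).frugalReachability

/-- The loop over `i = 1, 2, …`, where `fr` is `fr_i`, i.e. the thresholds of `R_{i-1}`, and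
`solveParity` solves the game `G_i` with given frugal target budgets on `F_d`. It ends when
`fr_i` and `fr_{i+1}` agree on `F_d`. -/
def FrugalParityGame.loop (G : FrugalParityGame V)
    (solveParity : (V → Budget) → Prog (V → Budget)) (fr : V → Budget) : Prog (V → Budget) :=
  Prog.loop (fun fr => do
    let thG ← solveParity fr
    let thR ← G.solveTop thG
    tick
    if ∀ v ∈ G.top, fr v = thR v then
      return Sum.inl fun v => if v ∈ G.top then fr v else thG v
    else return Sum.inr thR) fr

/-- The fixed-point algorithm for frugal-parity games. For an even maximal parity index `d` it
takes Player 1's perspective, so that `fr_0 = k + 1` on `F_d`; the case of an odd `d` is dual, so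
that `fr_0` is `0`, the dual of `k + 1`. -/
def FrugalParityGame.frugalParityThreshold (G : FrugalParityGame V) : Prog (V → Budget) := do
  tick
  if h : G.indices.card ≤ 1 then
    if Odd G.maxIndex then G.frugalSafety else G.frugalReachability
  else
    let fr₀ : V → Budget := fun _ => if Odd G.maxIndex then 0 else plain (G.k + 1)
    tick
    let thG₀ ← (G.subParity fr₀).frugalParityThreshold
    let thR₀ ← G.solveTop thG₀
    G.loop (fun f => do tick; (G.subParity f).frugalParityThreshold) thR₀
termination_by G.indices.card
decreasing_by
  all_goals exact G.card_indices_subParity_lt h _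

end Algorithm

end DiscreteBidding

/-! ### Averages and single bids -/

namespace DiscreteBidding

/-! In codes the average is `hi / 2 + (lo + 1) / 2`, and a budget of that size is enough for one
good bid: if the bid wins, moving to the neighbour of smallest value leaves at least `lo`; if it
loses, the opponent's payment raises the budget to at least `hi` (`exists_bid`). So a player can
stay at or above any function that dominates its own averages. Whether staying there wins depends on
the long-run behaviour of the play.

Correctness means that the output is sound for both players: Player 1 has a positional strategy that
wins from every budget at or above it (`Enforces`), and so does Player 2, with the complementary
budgets, in the `dual` game. Duality subtracts budgets from `k + 1` and shifts indices by one, so an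
even largest index can be assumed.

In that case the budgets `fr_i` decrease. For Player 1 every stage is enforceable by induction: play
the subgame until a new sink is reached with enough budget, then switch to the strategy of the
previous stage (`Truncates.compose`). For Player 2 the fixed point matters: the averages now also
hold on the top vertices, so he can pass through them without falling below his budgets. If the top
is visited infinitely often, its index decides for him; otherwise a tail of the play lives in `G_i`,
where he wins by recursion (`Truncates.recur`). Value iteration is the same argument in its simplest
form: finitely many single moves for one player, staying forever for the other.

Each unsuccessful round lowers a sum of budgets over the top vertices, which bounds the number of
rounds. The recursion for the running time is solved by a bound of the form `t * n! ≤ (11 * N) ^ n`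
for `n` indices: the index classes partition the non-sinks, so binomial coefficients appear, and the
factorial absorbs the exponential constant. -/

theorem average_eq (hi lo : ℕ) : average hi lo = hi / 2 + (lo + 1) / 2 := by
  simp only [average, intPart, HasAdv, plain, starred, Budget, Nat.even_iff, Nat.odd_iff]
  split_ifs <;> omega

theorem average_mono {hi lo hi' lo' : ℕ} (h : hi ≤ hi') (h' : lo ≤ lo') :
    average hi lo ≤ average hi' lo' := by
  simp only [average_eq, Budget]; omega

/-- The right bid is the largest legal one that leaves `lo`. Without the advantage, bids are even
but ties are won, so a lost bid was exceeded by at least one. With it, ties are lost but the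
opponent's bids are even, which gains one unless the bid itself is even. The negated condition is
Player 1's winning test in `stepConfig`. -/
theorem exists_bid {B lo hi k : ℕ} (h : lo ≤ hi) (hB : average hi lo ≤ B) (hk : B ≤ starred k) :
    ∃ b, LegalBid B b ∧ lo ≤ B - b ∧
      ∀ c, LegalBid (starred k - B) c → ¬ (c < b ∨ (b = c ∧ ¬ HasAdv B)) → hi ≤ B + c := by
  simp only [average_eq, LegalBid, HasAdv, starred, Budget] at *
  rcases Nat.mod_two_eq_zero_or_one B with h0 | h0
  · exact ⟨B - 2 * ((lo + 1) / 2), ⟨by omega, by omega⟩, by omega, fun c hc hc' => by omega⟩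
  · exact ⟨B - lo, ⟨by omega, by omega⟩, by omega, fun c hc hc' => by omega⟩

/-! ### Enforceable budgets and ways to combine strategies -/

section Strategies

variable {V : Type*} [Fintype V] [DecidableEq V]

theorem FrugalGame.averageAt_mono (G : FrugalGame V) {T T' : V → Budget} (h : T ≤ T') {v : V}
    (hv : v ∉ G.S) : G.averageAt T v hv ≤ G.averageAt T' v hv :=
  average_mono (Finset.sup'_mono_fun fun u _ => h u) (Finset.inf'_mono_fun fun u _ => h u)

/-- A legal action of Player 2 at the configuration `c`. -/
def FrugalGame.Legal₂ (G : FrugalGame V) (c : Config V) (a : Action V) : Prop :=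
  LegalBid (G.budget₂ c.2) a.1 ∧ a.2 ∈ G.nbrs c.1

/-- A legal action of Player 1 at the configuration `c`. -/
def FrugalGame.Legal₁ (G : FrugalGame V) (c : Config V) (a : Action V) : Prop :=
  LegalBid c.2 a.1 ∧ a.2 ∈ G.nbrs c.1

theorem FrugalGame.stepConfig_le (G : FrugalGame V) {c : Config V} {a b : Action V}
    (hc : c.2 ≤ starred G.k) (hb : G.Legal₂ c b) : (stepConfig c a b).2 ≤ starred G.k := by
  have := hb.1.1
  unfold stepConfig
  simp only [FrugalGame.budget₂, Budget] at *
  split_ifs <;> simp only <;> omega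

/-- The configurations with enough budget for Player 1, according to `T`. -/
def FrugalGame.region (G : FrugalGame V) (T : V → Budget) : Set (Config V) :=
  {c | T c.1 ≤ c.2 ∧ c.2 ≤ starred G.k}

theorem FrugalGame.exists_response (G : FrugalGame V) (T : V → Budget) {c : Config V}
    (hv : c.1 ∉ G.S) (hB : G.averageAt T c.1 hv ≤ c.2) (hk : c.2 ≤ starred G.k) :
    ∃ a, G.Legal₁ c a ∧ ∀ b, G.Legal₂ c b → stepConfig c a b ∈ G.region T := by
  obtain ⟨u, hu, hu'⟩ := Finset.exists_mem_eq_inf' (G.nbrs_nonempty hv) T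
  obtain ⟨x, hx⟩ := G.nbrs_nonempty hv
  obtain ⟨b, hb, hlo, hhi⟩ := exists_bid
    ((Finset.inf'_le T hx).trans (Finset.le_sup' T hx)) hB hk
  refine ⟨(b, u), ⟨hb, hu⟩, fun a₂ ha₂ => ⟨?_, G.stepConfig_le hk ha₂⟩⟩
  unfold stepConfig
  split_ifs with h
  · simpa only [← hu'] using hlo
  · exact (Finset.le_sup' T ha₂.2).trans (hhi _ ha₂.1 h)

open Classical in
/-- A move of Player 1 that guarantees that the next configuration has enough budget
for `T`, wherever there is such a move. -/
noncomputable def FrugalGame.respond (G : FrugalGame V) (T : V → Budget) (c : Config V) : Action V :=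
  if h : ∃ a, G.Legal₁ c a ∧ ∀ b, G.Legal₂ c b → stepConfig c a b ∈ G.region T then h.choose
  else (0, c.1)

theorem FrugalGame.respond_spec (G : FrugalGame V) (T : V → Budget) {c : Config V}
    (hv : c.1 ∉ G.S) (hB : G.averageAt T c.1 hv ≤ c.2) (hk : c.2 ≤ starred G.k) :
    G.Legal₁ c (G.respond T c) ∧
      ∀ b, G.Legal₂ c b → stepConfig c (G.respond T c) b ∈ G.region T := by
  have h := G.exists_response T hv hB hk
  rw [FrugalGame.respond, dif_pos h]
  exact h.choose_spec

/-- `π` is a play in which Player 1 uses the positional strategy `σ`. -/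
structure FrugalGame.Follows (G : FrugalGame V) (σ : Config V → Action V) (π : ℕ → Config V) :
    Prop where
  stay : ∀ n, (π n).1 ∈ G.S → π (n + 1) = π n
  move : ∀ n, (π n).1 ∉ G.S → ∃ b, G.Legal₂ (π n) b ∧ π (n + 1) = stepConfig (π n) (σ (π n)) b

theorem FrugalGame.Follows.tail {G : FrugalGame V} {σ : Config V → Action V} {π : ℕ → Config V}
    (h : G.Follows σ π) (N : ℕ) : G.Follows σ (fun n => π (n + N)) where
  stay n hn := by
    have := h.stay (n + N) hn
    rwa [Nat.add_right_comm] at this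
  move n hn := by
    obtain ⟨b, hb, e⟩ := h.move (n + N) hn
    exact ⟨b, hb, by rwa [Nat.add_right_comm] at e⟩

omit [Fintype V] [DecidableEq V] in
theorem stay_of_sink {S : Finset V} {π : ℕ → Config V}
    (h : ∀ n, (π n).1 ∈ S → π (n + 1) = π n) {n : ℕ} (hn : (π n).1 ∈ S) (m : ℕ) :
    π (n + m) = π n := by
  induction m with
  | zero => rfl
  | succ m ih => rw [← Nat.add_assoc, h (n + m) (by rwa [ih]), ih]

omit [Fintype V] [DecidableEq V] in
theorem infVisited_tail (π : ℕ → Config V) (N : ℕ) :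
    infVisited (fun n => π (n + N)) = infVisited π := by
  ext v
  simp only [infVisited, Set.mem_ofPred_eq, Filter.frequently_atTop]
  constructor
  · intro h a
    obtain ⟨b, hb, e⟩ := h a
    exact ⟨b + N, by omega, e⟩
  · intro h a
    obtain ⟨b, hb, e⟩ := h (a + N)
    exact ⟨b - N, by omega, by rwa [Nat.sub_add_cancel (by omega)]⟩

theorem FrugalParityGame.Objective.of_tail {G : FrugalParityGame V} {π : ℕ → Config V}
    (h : ∀ n, (π n).1 ∈ G.S → π (n + 1) = π n) {N : ℕ}
    (hN : G.Objective (fun n => π (n + N))) : G.Objective π := by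
  rcases hN with ⟨n, hn⟩ | ⟨hn, h2⟩
  · exact Or.inl ⟨n + N, hn⟩
  · rw [infVisited_tail] at h2
    refine Or.inr ⟨fun n hS => ?_, h2⟩
    have := stay_of_sink h hS N
    exact hn n (by simpa only [this] using hS)

/-- The positional strategy `σ` of Player 1 keeps the budget at or above `T`, and wins from every
configuration where it is. -/
structure FrugalParityGame.Enforces (G : FrugalParityGame V) (T : V → Budget)
    (σ : Config V → Action V) : Prop where
  legal : ∀ c ∈ G.region T, c.1 ∉ G.S → G.Legal₁ c (σ c)
  step : ∀ c ∈ G.region T, c.1 ∉ G.S → ∀ b, G.Legal₂ c b → stepConfig c (σ c) b ∈ G.region T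
  wins : ∀ π, G.Follows σ π → π 0 ∈ G.region T → G.Objective π

theorem FrugalParityGame.region_of_follows {G : FrugalParityGame V} {T : V → Budget}
    {σ : Config V → Action V}
    (hσ : ∀ c ∈ G.region T, c.1 ∉ G.S → ∀ b, G.Legal₂ c b → stepConfig c (σ c) b ∈ G.region T)
    {π : ℕ → Config V} (h : G.Follows σ π)
    (h0 : π 0 ∈ G.region T) (n : ℕ) : π n ∈ G.region T := by
  induction n with
  | zero => exact h0
  | succ n ih =>
    by_cases hS : (π n).1 ∈ G.S
    · rwa [h.stay n hS]
    · obtain ⟨b, hb, e⟩ := h.move n hS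
      rw [e]
      exact hσ _ ih hS b hb

/-- Only sinks where Player 1's budget suffices are in the region of the initial function of
value iteration for reachability. -/
theorem FrugalParityGame.enforces_initial (G : FrugalParityGame V) :
    ∃ σ, G.Enforces (G.initial (plain (G.k + 1))) σ := by
  have key : ∀ c ∈ G.region (G.initial (plain (G.k + 1))), c.1 ∈ G.S ∧ G.fr c.1 ≤ c.2 := by
    rintro c ⟨h1, h2⟩
    simp only [FrugalGame.initial, plain, starred, Budget] at h1 h2
    split_ifs at h1 with h
    · exact ⟨h, h1⟩
    · omega
  exact ⟨fun c => (0, c.1), fun c hc hS => absurd (key c hc).1 hS,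
    fun c hc hS => absurd (key c hc).1 hS, fun π _ h0 => Or.inl ⟨0, key _ h0⟩⟩

open Classical in
-- One move of `respond` leads from the region of `T` into that of `X`, which `σ` never leaves. This
-- is a round of value iteration read as a strategy.
theorem FrugalParityGame.Enforces.improve {G : FrugalParityGame V} {X T : V → Budget}
    {σ : Config V → Action V} (h : G.Enforces X σ) (hTX : T ≤ X)
    (hS : ∀ s ∈ G.S, T s = X s) (hT : ∀ v (hv : v ∉ G.S), G.averageAt X v hv ≤ T v) :
    ∃ τ, G.Enforces T τ := by
  have hsub : G.region X ⊆ G.region T := fun c hc => ⟨(hTX _).trans hc.1, hc.2⟩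
  let τ : Config V → Action V := fun c => if c ∈ G.region X then σ c else G.respond X c
  have hτ : ∀ c ∈ G.region T, c.1 ∉ G.S →
      G.Legal₁ c (τ c) ∧ ∀ b, G.Legal₂ c b → stepConfig c (τ c) b ∈ G.region X := by
    intro c hc hv
    by_cases hX : c ∈ G.region X
    · simp only [τ, if_pos hX]
      exact ⟨h.legal c hX hv, h.step c hX hv⟩
    · simp only [τ, if_neg hX]
      exact G.respond_spec X hv ((hT _ hv).trans hc.1) hc.2
  have hwin : ∀ π, G.Follows τ π → π 0 ∈ G.region X → G.Objective π := by
    intro π hπ h0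
    have hr : ∀ n, π n ∈ G.region X :=
      G.region_of_follows (fun c hc hv => (hτ c (hsub hc) hv).2) hπ h0
    refine h.wins π ⟨hπ.stay, fun n hn => ?_⟩ h0
    obtain ⟨b, hb, e⟩ := hπ.move n hn
    exact ⟨b, hb, by simpa only [τ, if_pos (hr n)] using e⟩
  refine ⟨τ, fun c hc hv => (hτ c hc hv).1, fun c hc hv b hb => hsub ((hτ c hc hv).2 b hb),
    fun π hπ h0 => ?_⟩
  by_cases hv : (π 0).1 ∈ G.S
  · exact hwin π hπ ⟨(hS _ hv).symm.trans_le h0.1, h0.2⟩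
  · obtain ⟨b, hb, e⟩ := hπ.move 0 hv
    refine FrugalParityGame.Objective.of_tail (N := 1) hπ.stay (hwin _ (hπ.tail 1) ?_)
    rw [e]
    exact (hτ _ h0 hv).2 b hb

/-- `H` is obtained from `G` by turning some vertices into sinks. -/
structure FrugalParityGame.Truncates (H G : FrugalParityGame V) : Prop where
  budget : H.k = G.k
  sinks : G.S ⊆ H.S
  nbrs : ∀ v ∉ H.S, H.nbrs v = G.nbrs v
  target : ∀ v ∈ G.S, H.fr v = G.fr v
  index : ∀ v ∉ H.S, H.p v = G.p v

namespace FrugalParityGame.Truncates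

variable {H G : FrugalParityGame V} (hH : H.Truncates G)
include hH

theorem region (T : V → Budget) : H.region T = G.region T := by
  simp only [FrugalGame.region, hH.budget]

theorem legal₁ {c : Config V} (hc : c.1 ∉ H.S) (a : Action V) : H.Legal₁ c a ↔ G.Legal₁ c a := by
  simp only [FrugalGame.Legal₁, hH.nbrs _ hc]

theorem legal₂ {c : Config V} (hc : c.1 ∉ H.S) (a : Action V) : H.Legal₂ c a ↔ G.Legal₂ c a := by
  simp only [FrugalGame.Legal₂, hH.nbrs _ hc, FrugalGame.budget₂, hH.budget]

theorem follows {σ τ : Config V → Action V} {π : ℕ → Config V} (h : G.Follows τ π)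
    (hn : ∀ n, (π n).1 ∈ H.S → (π n).1 ∈ G.S)
    (he : ∀ n, (π n).1 ∉ H.S → τ (π n) = σ (π n)) : H.Follows σ π where
  stay n hS := h.stay n (hn n hS)
  move n hS := by
    obtain ⟨b, hb, e⟩ := h.move n (fun h' => hS (hH.sinks h'))
    exact ⟨b, (hH.legal₂ hS b).2 hb, by rw [e, he n hS]⟩

theorem objective {π : ℕ → Config V} (h : H.Objective π)
    (hn : ∀ n, (π n).1 ∈ H.S → (π n).1 ∈ G.S) : G.Objective π := by
  rcases h with ⟨n, hS, hfr⟩ | ⟨hS, v, hv, hodd, hmax⟩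
  · exact Or.inl ⟨n, hn n hS, by rwa [← hH.target _ (hn n hS)]⟩
  · have hmem : ∀ u ∈ infVisited π, u ∉ H.S := by
      intro u hu
      obtain ⟨n, hn⟩ := Filter.Frequently.exists hu
      exact hn ▸ hS n
    refine Or.inr ⟨fun n h' => hS n (hH.sinks h'), v, hv, ?_, fun u hu => ?_⟩
    · rwa [← hH.index v (hmem v hv)]
    · rw [← hH.index v (hmem v hv), ← hH.index u (hmem u hu)]
      exact hmax u hu

open Classical in
/-- Play in the truncated game, and switch to a winning strategy at the new sinks. -/
theorem compose {X T : V → Budget} {σ τ : Config V → Action V} (hX : G.Enforces X σ)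
    (hT : H.Enforces T τ) (hTX : T ≤ X) (hs : ∀ v ∈ H.S, v ∉ G.S → X v ≤ T v) :
    ∃ ρ, G.Enforces T ρ := by
  have hsub : G.region X ⊆ G.region T := fun c hc => ⟨(hTX _).trans hc.1, hc.2⟩
  have hreg := hH.region T
  let ρ : Config V → Action V := fun c => if c ∈ G.region X then σ c else τ c
  -- A new sink reached with budget at least `T` already lies in the region of `X`, so before the
  -- switch no new sink is met.
  have hnew : ∀ c ∈ G.region T, c ∉ G.region X → c.1 ∉ G.S → c.1 ∉ H.S :=
    fun c hc hc' hG h' => hc' ⟨(hs _ h' hG).trans hc.1, hc.2⟩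
  have hstepX : ∀ c ∈ G.region X, c.1 ∉ G.S → ∀ b, G.Legal₂ c b →
      stepConfig c (ρ c) b ∈ G.region X := by
    intro c hc hv b hb
    simp only [ρ, if_pos hc]
    exact hX.step c hc hv b hb
  have hstep : ∀ c ∈ G.region T, c.1 ∉ G.S → ∀ b, G.Legal₂ c b →
      stepConfig c (ρ c) b ∈ G.region T := by
    intro c hc hv b hb
    by_cases hcX : c ∈ G.region X
    · exact hsub (hstepX c hcX hv b hb)
    · have hv' := hnew c hc hcX hv
      simp only [ρ, if_neg hcX]
      rw [← hreg]
      exact hT.step c (hreg ▸ hc) hv' b ((hH.legal₂ hv' b).2 hb)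
  refine ⟨ρ, fun c hc hv => ?_, hstep, fun π hπ h0 => ?_⟩
  · by_cases hcX : c ∈ G.region X
    · simp only [ρ, if_pos hcX]
      exact hX.legal c hcX hv
    · have hv' := hnew c hc hcX hv
      simp only [ρ, if_neg hcX]
      exact (hH.legal₁ hv' _).1 (hT.legal c (hreg ▸ hc) hv')
  · have hr := G.region_of_follows hstep hπ h0
    -- The region of `X` is never left again, so either a tail of the play follows `σ`, or the whole
    -- play follows `τ`.
    by_cases hex : ∃ N, π N ∈ G.region X
    · obtain ⟨N, hN⟩ := hex
      refine FrugalParityGame.Objective.of_tail (N := N) hπ.stay ?_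
      have hN' : (fun n => π (n + N)) 0 ∈ G.region X := by simpa using hN
      have hrX := G.region_of_follows hstepX (hπ.tail N) hN'
      refine hX.wins _ ⟨(hπ.tail N).stay, fun n hn => ?_⟩ hN'
      obtain ⟨b, hb, e⟩ := (hπ.tail N).move n hn
      exact ⟨b, hb, by simpa only [ρ, if_pos (hrX n)] using e⟩
    · push Not at hex
      have hS : ∀ n, (π n).1 ∈ H.S → (π n).1 ∈ G.S := fun n h' => by
        by_contra hG
        exact hnew _ (hr n) (hex n) hG h'
      exact hH.objective (hT.wins π (hH.follows hπ hS fun n _ => if_neg (hex n)) (hreg ▸ h0)) hS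

open Classical in
/-- If all the new sinks have the same odd index, which is maximal in `G`, then visiting them
infinitely often is winning. -/
theorem recur {T : V → Budget} {σ : Config V → Action V} {m : ℕ} (hm : Odd m)
    (hle : ∀ v ∉ G.S, G.p v ≤ m) (hnew : ∀ v ∈ H.S, v ∉ G.S → G.p v = m)
    (hfr : ∀ v ∈ G.S, G.fr v ≤ T v)
    (havg : ∀ v (hv : v ∉ G.S), v ∈ H.S → G.averageAt T v hv ≤ T v) (h : H.Enforces T σ) :
    ∃ τ, G.Enforces T τ := by
  have hreg := hH.region T
  let τ : Config V → Action V := fun c => if c.1 ∈ H.S then G.respond T c else σ c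
  have hτ : ∀ c ∈ G.region T, c.1 ∉ G.S →
      G.Legal₁ c (τ c) ∧ ∀ b, G.Legal₂ c b → stepConfig c (τ c) b ∈ G.region T := by
    intro c hc hv
    by_cases hS : c.1 ∈ H.S
    · simp only [τ, if_pos hS]
      exact G.respond_spec T hv ((havg _ hv hS).trans hc.1) hc.2
    · simp only [τ, if_neg hS]
      rw [← hreg] at hc ⊢
      exact ⟨(hH.legal₁ hS _).1 (h.legal c hc hS),
        fun b hb => h.step c hc hS b ((hH.legal₂ hS b).2 hb)⟩
  refine ⟨τ, fun c hc hv => (hτ c hc hv).1, fun c hc hv => (hτ c hc hv).2, fun π hπ h0 => ?_⟩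
  have hr := G.region_of_follows (fun c hc hv => (hτ c hc hv).2) hπ h0
  by_cases hsink : ∃ n, (π n).1 ∈ G.S
  · obtain ⟨n, hn⟩ := hsink
    exact Or.inl ⟨n, hn, (hfr _ hn).trans (hr n).1⟩
  push Not at hsink
  -- Either the new sinks recur, and by finiteness a single one does, or some tail avoids them and
  -- is a play of `H`.
  by_cases hinf : ∃ᶠ n in Filter.atTop, (π n).1 ∈ H.S
  · have : ∃ v, v ∈ H.S ∧ ∃ᶠ n in Filter.atTop, (π n).1 = v := by
      by_contra hcon
      push Not at hcon
      refine hinf ?_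
      have : ∀ᶠ n in Filter.atTop, ∀ v ∈ H.S, (π n).1 ≠ v :=
        (Finset.eventually_all H.S).2 fun v hv => Filter.not_frequently.1 (by simpa using hcon v hv)
      exact this.mono fun n hn hS => hn _ hS rfl
    obtain ⟨v, hv, hv'⟩ := this
    obtain ⟨n, hn⟩ := hv'.exists
    have hpv := hnew v hv (hn ▸ hsink n)
    refine Or.inr ⟨hsink, v, hv', hpv ▸ hm, fun u hu => ?_⟩
    obtain ⟨n, hn⟩ := Filter.Frequently.exists hu
    rw [hpv]
    exact hle u (hn ▸ hsink n)
  · obtain ⟨N, hN⟩ := Filter.eventually_atTop.1 (Filter.not_frequently.1 hinf)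
    refine FrugalParityGame.Objective.of_tail (N := N) hπ.stay ?_
    have hS : ∀ n, (π (n + N)).1 ∉ H.S := fun n => hN _ (by omega)
    refine hH.objective (h.wins _ (hH.follows (hπ.tail N) (fun n h' => absurd h' (hS n))
      fun n _ => if_neg (hS n)) ?_) fun n h' => absurd h' (hS n)
    rw [hreg]
    exact hr _

end FrugalParityGame.Truncates

/-- If all indices are equal and odd, it suffices to keep the budget at or above `T`. -/
theorem FrugalParityGame.enforces_of_odd (G : FrugalParityGame V) {m : ℕ} (hm : Odd m)
    (hp : ∀ v ∉ G.S, G.p v = m) {T : V → Budget} (hfr : ∀ v ∈ G.S, G.fr v = T v)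
    (havg : ∀ v (hv : v ∉ G.S), G.averageAt T v hv ≤ T v) : ∃ σ, G.Enforces T σ := by
  -- With every vertex a sink of target `T`, enforcing `T` in `H` is trivial, and `recur` does the
  -- rest.
  let H : FrugalParityGame V :=
    { k := G.k, E := G.E, S := Finset.univ, fr := T, p := G.p, exists_edge := by simp }
  have hH : H.Truncates G :=
    ⟨rfl, Finset.subset_univ _, fun v hv => absurd (Finset.mem_univ v) hv,
      fun v hv => (hfr v hv).symm, fun v _ => rfl⟩
  refine hH.recur (σ := fun c => (0, c.1)) hm (fun v hv => (hp v hv).le) (fun v _ hv => hp v hv)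
    (fun v hv => (hfr v hv).le) (fun v hv _ => havg v hv) ⟨?_, ?_, ?_⟩
  · exact fun c _ hc => absurd (Finset.mem_univ _) hc
  · exact fun c _ hc => absurd (Finset.mem_univ _) hc
  · exact fun π _ h0 => Or.inl ⟨0, Finset.mem_univ _, h0.1⟩

end Strategies

/-! ### Exchanging the players -/

section Duality

variable {V : Type*} [Fintype V] [DecidableEq V]

/-- Player 2's threshold budgets, if `T` is the function of Player 1's. -/
def FrugalGame.compl (G : FrugalGame V) (T : V → Budget) : V → Budget :=
  fun v => plain (G.k + 1) - T v

/-- The game with the roles of the players exchanged. -/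
def FrugalParityGame.dual (G : FrugalParityGame V) : FrugalParityGame V where
  k := G.k
  E := G.E
  S := G.S
  fr := G.compl G.fr
  exists_edge := G.exists_edge
  p := fun v => G.p v + 1

/-- The configuration from the perspective of Player 2. -/
def FrugalGame.flip (G : FrugalGame V) (c : Config V) : Config V := (c.1, G.budget₂ c.2)

theorem FrugalGame.flip_le (G : FrugalGame V) (c : Config V) : (G.flip c).2 ≤ starred G.k :=
  Nat.sub_le _ _

theorem FrugalGame.compl_compl (G : FrugalGame V) {T : V → Budget}
    (hT : ∀ v, T v ≤ plain (G.k + 1)) : G.compl (G.compl T) = T :=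
  funext fun v => Nat.sub_sub_self (hT v)

theorem FrugalGame.compl_le (G : FrugalGame V) (T : V → Budget) (v : V) :
    G.compl T v ≤ plain (G.k + 1) :=
  Nat.sub_le _ _

theorem FrugalGame.averageAt_le (G : FrugalGame V) {T : V → Budget}
    (hT : ∀ v, T v ≤ plain (G.k + 1)) {v : V} (hv : v ∉ G.S) :
    G.averageAt T v hv ≤ plain (G.k + 1) := by
  obtain ⟨x, hx⟩ := G.nbrs_nonempty hv
  have h := average_mono (Finset.sup'_le (G.nbrs_nonempty hv) T fun u _ => hT u)
    ((Finset.inf'_le T hx).trans (hT x))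
  refine h.trans ?_
  simp only [average_eq, plain, Budget]
  omega

/-- The code `plain M` is even, so subtracting from it exchanges rounding down and rounding up, just
as it exchanges largest and smallest. -/
theorem average_sub {M hi lo : ℕ} (hhi : hi ≤ plain M) (hlo : lo ≤ plain M) :
    average (plain M - lo) (plain M - hi) = plain M - average hi lo := by
  simp only [average_eq, plain, Budget] at *
  omega

theorem FrugalParityGame.averageAt_dual (G : FrugalParityGame V) {T : V → Budget}
    (hT : ∀ v, T v ≤ plain (G.k + 1)) {v : V} (hv : v ∉ G.S) :
    G.dual.averageAt (G.compl T) v hv = plain (G.k + 1) - G.averageAt T v hv := by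
  have hne := G.nbrs_nonempty hv
  have h1 : (G.nbrs v).sup' hne (G.compl T) = plain (G.k + 1) - (G.nbrs v).inf' hne T := by
    obtain ⟨u, hu, e⟩ := Finset.exists_mem_eq_inf' hne T
    refine le_antisymm (Finset.sup'_le _ _ fun x hx => Nat.sub_le_sub_left (Finset.inf'_le T hx) _) ?_
    rw [e]
    exact Finset.le_sup' (G.compl T) hu
  have h2 : (G.nbrs v).inf' hne (G.compl T) = plain (G.k + 1) - (G.nbrs v).sup' hne T := by
    obtain ⟨u, hu, e⟩ := Finset.exists_mem_eq_sup' hne T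
    refine le_antisymm ?_ (Finset.le_inf' _ _ fun x hx => Nat.sub_le_sub_left (Finset.le_sup' T hx) _)
    rw [e]
    exact Finset.inf'_le (G.compl T) hu
  have h3 : (G.nbrs v).sup' hne T ≤ plain (G.k + 1) := Finset.sup'_le _ _ fun x _ => hT x
  have h4 : (G.nbrs v).inf' hne T ≤ plain (G.k + 1) := by
    obtain ⟨x, hx⟩ := hne
    exact (Finset.inf'_le T hx).trans (hT x)
  change average ((G.nbrs v).sup' hne (G.compl T)) ((G.nbrs v).inf' hne (G.compl T)) = _
  rw [h1, h2]
  exact average_sub h3 h4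

theorem FrugalParityGame.sweep_dual (G : FrugalParityGame V) {T : V → Budget}
    (hT : ∀ v, T v ≤ plain (G.k + 1)) : G.dual.sweep (G.compl T) = G.compl (G.sweep T) := by
  funext v
  by_cases hv : v ∈ G.S
  · have hv' : v ∈ G.dual.S := hv
    simp only [FrugalGame.sweep, dif_pos hv, dif_pos hv', FrugalGame.compl]
    rfl
  · have hv' : v ∉ G.dual.S := hv
    simp only [FrugalGame.sweep, dif_neg hv', FrugalGame.compl, dif_neg hv]
    exact G.averageAt_dual hT hv

/-- The two budgets add up to the odd code `starred k`, so exactly one player holds the advantage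
and the tie rule is symmetric. -/
theorem wins_bid_flip {k B x y : ℕ} (hB : B ≤ starred k) :
    (x < y ∨ y = x ∧ ¬ HasAdv (starred k - B)) ↔ ¬ (y < x ∨ x = y ∧ ¬ HasAdv B) := by
  simp only [HasAdv, starred, Budget] at *
  omega

theorem FrugalGame.stepConfig_flip (G : FrugalGame V) {c : Config V} {a b : Action V}
    (hc : c.2 ≤ starred G.k) (ha : G.Legal₁ c a) :
    stepConfig (G.flip c) b a = G.flip (stepConfig c a b) := by
  have key : (a.1 < b.1 ∨ b.1 = a.1 ∧ ¬ HasAdv (G.flip c).2) ↔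
    ¬ (b.1 < a.1 ∨ a.1 = b.1 ∧ ¬ HasAdv c.2) := wins_bid_flip hc
  by_cases h : b.1 < a.1 ∨ a.1 = b.1 ∧ ¬ HasAdv c.2
  · rw [stepConfig, stepConfig, if_neg (fun h' => key.1 h' h), if_pos h]
    exact Prod.ext rfl (tsub_tsub_assoc hc ha.1.1).symm
  · rw [stepConfig, stepConfig, if_pos (key.2 h), if_neg h]
    exact Prod.ext rfl (Nat.sub_sub _ _ _)

theorem FrugalParityGame.legal₂_dual (G : FrugalParityGame V) {c : Config V}
    (hc : c.2 ≤ starred G.k) (a : Action V) :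
    G.dual.Legal₂ (G.flip c) a ↔ G.Legal₁ c a := by
  have : G.dual.budget₂ (G.flip c).2 = c.2 := Nat.sub_sub_self hc
  simp only [FrugalGame.Legal₂, this]
  rfl

theorem infVisited_flip (G : FrugalGame V) (π : ℕ → Config V) :
    infVisited (fun n => G.flip (π n)) = infVisited π := rfl

/-- At a sink the two targets would add up to `2 * (k + 1)`, but the budgets only to `2 * k + 1`. In
an infinite play the largest recurring index cannot be both odd and, after the shift, even. -/
theorem FrugalParityGame.not_objective_of_dual {G : FrugalParityGame V} {π : ℕ → Config V}
    (hS : ∀ n, (π n).1 ∈ G.S → π (n + 1) = π n) (hk : ∀ n, (π n).2 ≤ starred G.k)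
    (h : G.dual.Objective (fun n => G.flip (π n))) : ¬ G.Objective π := by
  rintro (⟨n, hn, hfr⟩ | ⟨hn, v, hv, hodd, hmax⟩)
  · rcases h with ⟨m, hm, hfr'⟩ | ⟨hm, -⟩
    · have e : π n = π m := by
        rw [← stay_of_sink hS hn m, ← stay_of_sink hS hm n, Nat.add_comm]
      have := hk m
      rw [e] at hfr
      simp only [FrugalParityGame.dual, FrugalGame.flip, FrugalGame.compl, FrugalGame.budget₂,
        plain, starred, Budget] at hfr hfr' this
      omega
    · exact hm n hn
  · rcases h with ⟨m, hm, -⟩ | ⟨-, u, hu, hodd', hmax'⟩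
    · exact hn m hm
    · rw [infVisited_flip] at hu hmax'
      have h1 := hmax u hu
      have h2 : G.p v + 1 ≤ G.p u + 1 := hmax' v hv
      have h3 : Odd (G.p u + 1) := hodd'
      rw [Nat.odd_iff] at hodd h3
      omega

/-- The double dual is not `G` itself: indices have grown by two, and targets are known to be
restored only on the sinks. The objective is unaffected. -/
theorem FrugalParityGame.enforces_dual_dual {G : FrugalParityGame V}
    (hfr : ∀ s ∈ G.S, G.fr s ≤ plain (G.k + 1)) {T : V → Budget} {σ : Config V → Action V} :
    G.dual.dual.Enforces T σ ↔ G.Enforces T σ := by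
  have hfr' : ∀ s ∈ G.S, G.dual.dual.fr s = G.fr s := fun s hs => Nat.sub_sub_self (hfr s hs)
  have hobj : ∀ π, G.dual.dual.Objective π ↔ G.Objective π := by
    intro π
    refine or_congr (exists_congr fun n => and_congr_right fun hn => by rw [hfr' _ hn])
      (and_congr_right fun _ => exists_congr fun v => and_congr_right fun _ => and_congr ?_ ?_)
    · change Odd (G.p v + 1 + 1) ↔ Odd (G.p v)
      simp only [Nat.odd_iff]
      omega
    · refine forall_congr' fun u => forall_congr' fun _ => ?_
      change G.p u + 1 + 1 ≤ G.p v + 1 + 1 ↔ _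
      omega
  constructor
  · intro h
    exact ⟨h.legal, h.step, fun π hπ h0 => (hobj π).1 (h.wins π ⟨hπ.stay, hπ.move⟩ h0)⟩
  · intro h
    exact ⟨h.legal, h.step, fun π hπ h0 => (hobj π).2 (h.wins π ⟨hπ.stay, hπ.move⟩ h0)⟩

open Classical in
-- A `Strategy₁` must be legal everywhere, but `Enforces` constrains `σ` only in its region;
-- elsewhere a bid of zero is a safe default.
theorem FrugalParityGame.Enforces.exists_legal {G : FrugalParityGame V} {T : V → Budget}
    {σ : Config V → Action V} (h : G.Enforces T σ) :
    ∃ τ, G.Enforces T τ ∧ ∀ c, c.1 ∉ G.S → G.Legal₁ c (τ c) := by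
  have hd : ∀ c : Config V, ∃ a, c.1 ∉ G.S → G.Legal₁ c a := by
    intro c
    by_cases hc : c.1 ∈ G.S
    · exact ⟨(0, c.1), fun h => absurd hc h⟩
    · obtain ⟨u, hu⟩ := G.nbrs_nonempty hc
      exact ⟨(0, u), fun _ => ⟨⟨Nat.zero_le _, fun h => absurd h (by simp [HasAdv])⟩, hu⟩⟩
  choose d hd using hd
  let τ : Config V → Action V := fun c => if G.Legal₁ c (σ c) then σ c else d c
  have hτ : ∀ c ∈ G.region T, c.1 ∉ G.S → τ c = σ c := fun c hc hv => if_pos (h.legal c hc hv)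
  have hstep : ∀ c ∈ G.region T, c.1 ∉ G.S → ∀ b, G.Legal₂ c b →
      stepConfig c (τ c) b ∈ G.region T := by
    intro c hc hv b hb
    rw [hτ c hc hv]
    exact h.step c hc hv b hb
  refine ⟨τ, ⟨fun c hc hv => ?_, hstep, fun π hπ h0 => h.wins π ⟨hπ.stay, fun n hn => ?_⟩ h0⟩, ?_⟩
  · rw [hτ c hc hv]
    exact h.legal c hc hv
  · obtain ⟨b, hb, e⟩ := hπ.move n hn
    exact ⟨b, hb, by rw [e, hτ _ (region_of_follows hstep hπ h0 n) hn]⟩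
  · intro c hc
    simp only [τ]
    split_ifs with h'
    · exact h'
    · exact hd c hc

theorem FrugalGame.play_stay (G : FrugalGame V) (f : Strategy₁ G) (g : Strategy₂ G) (c : Config V)
    {n : ℕ} (hn : (G.play f g c n).1 ∈ G.S) : G.play f g c (n + 1) = G.play f g c n := by
  simp only [FrugalGame.play, FrugalGame.run] at *
  rw [if_pos hn]

theorem FrugalGame.play_move (G : FrugalGame V) (f : Strategy₁ G) (g : Strategy₂ G) (c : Config V)
    {n : ℕ} (hn : (G.play f g c n).1 ∉ G.S) :
    G.play f g c (n + 1) = stepConfig (G.play f g c n)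
      (f.act (G.run f g c n).1 (G.play f g c n)) (g.act (G.run f g c n).1 (G.play f g c n)) := by
  simp only [FrugalGame.play, FrugalGame.run] at *
  rw [if_neg hn]

theorem FrugalGame.play_le (G : FrugalGame V) (f : Strategy₁ G) (g : Strategy₂ G) {c : Config V}
    (hc : c.2 ≤ starred G.k) (n : ℕ) : (G.play f g c n).2 ≤ starred G.k := by
  induction n with
  | zero => exact hc
  | succ n ih =>
    by_cases hn : (G.play f g c n).1 ∈ G.S
    · rwa [G.play_stay f g c hn]
    · rw [G.play_move f g c hn]
      exact G.stepConfig_le ih (g.legal _ _ hn ih)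

theorem FrugalParityGame.Enforces.wins₁ {G : FrugalParityGame V} {T : V → Budget}
    {σ : Config V → Action V} (h : G.Enforces T σ) {c : Config V} (hc : c ∈ G.region T) :
    G.Wins₁ c := by
  obtain ⟨τ, hτ, hl⟩ := h.exists_legal
  refine ⟨⟨fun _ => τ, fun _ c hv _ => hl c hv⟩, fun g => hτ.wins _ ⟨fun n hn => ?_, fun n hn => ?_⟩ hc⟩
  · exact G.play_stay _ g c hn
  · exact ⟨_, g.legal _ _ hn (G.play_le _ g hc.2 n), G.play_move _ g c hn⟩

theorem FrugalParityGame.Enforces.wins₂ {G : FrugalParityGame V} {T : V → Budget}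
    {σ : Config V → Action V} (h : G.dual.Enforces T σ) {c : Config V} (hk : c.2 ≤ starred G.k)
    (hc : G.flip c ∈ G.dual.region T) : G.Wins₂ c := by
  obtain ⟨τ, hτ, hl⟩ := h.exists_legal
  let g : Strategy₂ G.toFrugalGame :=
    ⟨fun _ c => τ (G.flip c), fun _ c hv _ => hl (G.flip c) hv⟩
  refine ⟨g, fun f => ?_⟩
  refine not_objective_of_dual (fun n hn => G.play_stay f g c hn) (G.play_le f g hk)
    (hτ.wins _ ⟨fun n hn => ?_, fun n hn => ?_⟩ hc)
  · exact congrArg _ (G.play_stay f g c hn)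
  · have hle := G.play_le f g hk n
    have hf := f.legal (G.run f g c n).1 (G.play f g c n) hn hle
    refine ⟨_, (G.legal₂_dual hle _).2 hf, ?_⟩
    rw [G.play_move f g c hn]
    exact (G.stepConfig_flip hle hf).symm

/-- `T` is sound for both players and has the average property. -/
structure FrugalParityGame.Solves (G : FrugalParityGame V) (T : V → Budget) : Prop where
  enforces : ∃ σ, G.Enforces T σ
  enforces_dual : ∃ σ, G.dual.Enforces (G.compl T) σ
  average : G.AverageProperty T

theorem FrugalParityGame.Solves.isThreshold {G : FrugalParityGame V} {T : V → Budget}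
    (h : G.Solves T) : G.IsThreshold T := by
  obtain ⟨σ, hσ⟩ := h.enforces
  obtain ⟨τ, hτ⟩ := h.enforces_dual
  refine fun v => ⟨h.average.1 v, fun B hB => ⟨fun hT => hσ.wins₁ ⟨hT, hB⟩, fun hT =>
    hτ.wins₂ hB ⟨?_, G.flip_le _⟩⟩⟩
  have := h.average.1 v
  simp only [FrugalGame.flip, FrugalGame.compl, FrugalGame.budget₂, plain, starred, Budget] at *
  omega

theorem FrugalParityGame.wins₁_mono {G H : FrugalParityGame V} (hk : H.k = G.k) (hE : H.E = G.E)
    (hS : H.S = G.S) (hp : H.p = G.p) (hfr : ∀ s ∈ G.S, H.fr s ≤ G.fr s) {c : Config V}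
    (h : G.Wins₁ c) : H.Wins₁ c := by
  obtain ⟨⟨k, E, S, fr, hex⟩, p⟩ := G
  obtain ⟨⟨k', E', S', fr', hex'⟩, p'⟩ := H
  simp only at hk hE hS hp hfr
  subst hk hE hS hp
  obtain ⟨f, hf⟩ := h
  refine ⟨⟨f.act, f.legal⟩, fun g => ?_⟩
  have hrun : ∀ n, FrugalGame.run ⟨k', E', S', fr, hex⟩ f ⟨g.act, g.legal⟩ c n =
      FrugalGame.run ⟨k', E', S', fr', hex'⟩ ⟨f.act, f.legal⟩ g c n := by
    intro n
    induction n with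
    | zero => rfl
    | succ n ih => simp only [FrugalGame.run, ih]
  have hplay := funext fun n => congrArg Prod.snd (hrun n)
  rcases hf ⟨g.act, g.legal⟩ with ⟨n, hn, hle⟩ | h
  · refine Or.inl ⟨n, ?_⟩
    have e := congrFun hplay n
    simp only [FrugalGame.play, e] at hn hle ⊢
    exact ⟨hn, (hfr _ hn).trans hle⟩
  · refine Or.inr ?_
    have e : FrugalGame.play ⟨k', E', S', fr, hex⟩ f ⟨g.act, g.legal⟩ c =
      FrugalGame.play ⟨k', E', S', fr', hex'⟩ ⟨f.act, f.legal⟩ g c := hplay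
    rw [← e]
    exact h

/-- The comparison is semantic: if `T v < U v`, then with budget `T v` both players would win in
`H`. No induction along the algorithm is needed. -/
theorem FrugalParityGame.Solves.mono {G H : FrugalParityGame V} (hk : H.k = G.k) (hE : H.E = G.E)
    (hS : H.S = G.S) (hp : H.p = G.p) (hfr : ∀ s ∈ G.S, H.fr s ≤ G.fr s) {T U : V → Budget}
    (hT : G.Solves T) (hU : H.Solves U) : U ≤ T := by
  intro v
  by_contra! hlt
  have hB : T v ≤ starred G.k := by
    have := hU.average.1 v
    rw [hk] at this
    simp only [plain, starred, Budget] at *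
    omega
  obtain ⟨f, hf⟩ := wins₁_mono hk hE hS hp hfr (((hT.isThreshold v).2 _ hB).1 le_rfl)
  obtain ⟨g, hg⟩ := ((hU.isThreshold v).2 _ (hk ▸ hB)).2 hlt
  exact hg f (hf g)

theorem FrugalParityGame.Solves.dual {G : FrugalParityGame V} {T : V → Budget}
    (hfr : ∀ s ∈ G.S, G.fr s ≤ plain (G.k + 1)) (h : G.Solves T) : G.dual.Solves (G.compl T) where
  enforces := h.enforces_dual
  enforces_dual := by
    have e : G.dual.compl (G.compl T) = T := G.compl_compl h.average.1
    rw [e]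
    simpa only [enforces_dual_dual hfr] using h.enforces
  average := by
    refine ⟨G.compl_le T, fun s hs => ?_, fun v hv => ?_⟩
    · exact congrArg (plain (G.k + 1) - ·) (h.average.2.1 s hs)
    · rw [G.averageAt_dual h.average.1 hv, ← h.average.2.2 v hv]
      rfl

theorem FrugalParityGame.Solves.of_dual {G : FrugalParityGame V} {T : V → Budget}
    (hfr : ∀ s ∈ G.S, G.fr s ≤ plain (G.k + 1)) (hT : ∀ v, T v ≤ plain (G.k + 1))
    (h : G.dual.Solves (G.compl T)) : G.Solves T where
  enforces := by
    have e : G.dual.compl (G.compl T) = T := G.compl_compl hT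
    have := h.enforces_dual
    rw [e] at this
    simpa only [enforces_dual_dual hfr] using this
  enforces_dual := h.enforces
  average := by
    refine ⟨hT, fun s hs => ?_, fun v hv => ?_⟩
    · have h1 : plain (G.k + 1) - T s = plain (G.k + 1) - G.fr s := h.average.2.1 s hs
      have h2 := hfr s hs
      have h3 := hT s
      simp only [plain, Budget] at *
      omega
    · have h1 := h.average.2.2 v hv
      rw [G.averageAt_dual hT hv] at h1
      have h1 : plain (G.k + 1) - T v = _ := h1
      have h2 := G.averageAt_le hT hv
      have h3 := hT v
      simp only [plain, Budget] at *
      omega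

end Duality

/-! ### Termination and cost of loops -/

section Programs

theorem Prog.HaltsWith.pure {α : Type*} (a : α) : (Pure.pure a : Prog α).HaltsWith a 0 :=
  Part.mem_some _

theorem Prog.HaltsWith.bind {α β : Type _} {m : Prog α} {f : α → Prog β} {a : α} {b : β} {s t : ℕ}
    (hm : m.HaltsWith a s) (hf : (f a).HaltsWith b t) : (m >>= f).HaltsWith b (s + t) :=
  Part.mem_bind_iff.2 ⟨(a, s), hm, (Part.mem_map_iff _).2 ⟨(b, t), hf, rfl⟩⟩

theorem tick_haltsWith : tick.HaltsWith PUnit.unit 1 := Part.mem_some _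

/-- A loop whose rounds preserve `Inv`, decrease `μ` and take at most `τ` units of time. -/
theorem Prog.loop_haltsWith {σ β : Type*} {body : σ → Prog (β ⊕ σ)} {Inv : σ → Prop} {μ : σ → ℕ}
    {τ : ℕ} {Post : β → Prop}
    (h : ∀ s, Inv s → ∃ t ≤ τ, (∃ b, Post b ∧ (body s).HaltsWith (Sum.inl b) t) ∨
      ∃ s', Inv s' ∧ μ s' < μ s ∧ (body s).HaltsWith (Sum.inr s') t)
    {s : σ} (hs : Inv s) :
    ∃ b t, (Prog.loop body s).HaltsWith b t ∧ Post b ∧ t ≤ (μ s + 1) * τ := by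
  -- The elapsed time is part of the loop state, so the induction needs an arbitrary starting time.
  have key : ∀ n s t₀, μ s = n → Inv s →
      ∃ b t, (b, t₀ + t) ∈ (Prog.round body).fix (s, t₀) ∧ Post b ∧ t ≤ (n + 1) * τ := by
    intro n
    induction n using Nat.strong_induction_on with
    | _ n ih =>
      rintro s t₀ rfl hs
      obtain ⟨t, ht, ⟨b, hb, hr⟩ | ⟨s', hs', hlt, hr⟩⟩ := h s hs
      · refine ⟨b, t, PFun.mem_fix_iff.2 (Or.inl ?_), hb, ht.trans (Nat.le_mul_of_pos_left _ (by omega))⟩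
        exact (Part.mem_map_iff _).2 ⟨_, hr, rfl⟩
      · obtain ⟨b, t', hfix, hb, ht'⟩ := ih _ hlt s' (t₀ + t) rfl hs'
        refine ⟨b, t + t', PFun.mem_fix_iff.2 (Or.inr ⟨(s', t₀ + t), ?_, ?_⟩), hb, ?_⟩
        · exact (Part.mem_map_iff _).2 ⟨_, hr, rfl⟩
        · rwa [← Nat.add_assoc]
        · calc t + t' ≤ τ + (μ s' + 1) * τ := by omega
            _ = (μ s' + 1 + 1) * τ := by ring
            _ ≤ (μ s + 1) * τ := Nat.mul_le_mul_right _ (by omega)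
  obtain ⟨b, t, hfix, hb, ht⟩ := key _ s 0 rfl hs
  exact ⟨b, t, by simpa [Prog.HaltsWith, Prog.loop] using hfix, hb, ht⟩

end Programs

/-! ### Value iteration and games with one index -/

section ValueIteration

variable {V : Type*} [Fintype V] [DecidableEq V]

theorem FrugalGame.iterate_haltsWith (G : FrugalGame V) {Inv : (V → Budget) → Prop}
    {μ : (V → Budget) → ℕ}
    (h : ∀ T, Inv T → G.sweep T ≠ T → Inv (G.sweep T) ∧ μ (G.sweep T) < μ T)
    {T : V → Budget} (hT : Inv T) :
    ∃ U t, (G.iterate T).HaltsWith U t ∧ (Inv U ∧ G.sweep U = U) ∧ t ≤ μ T + 1 := by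
  have := Prog.loop_haltsWith (τ := 1) (μ := μ) (Inv := Inv)
    (Post := fun U => Inv U ∧ G.sweep U = U)
    (body := fun T => do
      tick
      let T' := G.sweep T
      if T' = T then return Sum.inl T else return Sum.inr T') (fun T hT => ?_) hT
  · obtain ⟨U, t, h1, h2, h3⟩ := this
    exact ⟨U, t, h1, h2, h3.trans_eq (mul_one _)⟩
  · refine ⟨1, le_rfl, ?_⟩
    by_cases e : G.sweep T = T
    · refine Or.inl ⟨T, ⟨hT, e⟩, Prog.HaltsWith.bind (t := 0) tick_haltsWith ?_⟩
      simp only [if_pos e]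
      exact Prog.HaltsWith.pure _
    · refine Or.inr ⟨G.sweep T, (h T hT e).1, (h T hT e).2,
        Prog.HaltsWith.bind (t := 0) tick_haltsWith ?_⟩
      simp only [if_neg e]
      exact Prog.HaltsWith.pure _

theorem FrugalGame.sweep_mono (G : FrugalGame V) {T U : V → Budget} (h : T ≤ U) :
    G.sweep T ≤ G.sweep U := by
  intro v
  by_cases hv : v ∈ G.S
  · simp only [FrugalGame.sweep, dif_pos hv, le_refl]
  · simp only [FrugalGame.sweep, dif_neg hv]
    exact G.averageAt_mono h hv

theorem FrugalGame.sweep_le (G : FrugalGame V) (hfr : ∀ s ∈ G.S, G.fr s ≤ plain (G.k + 1))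
    {T : V → Budget} (hT : ∀ v, T v ≤ plain (G.k + 1)) (v : V) :
    G.sweep T v ≤ plain (G.k + 1) := by
  by_cases hv : v ∈ G.S
  · simp only [FrugalGame.sweep, dif_pos hv, hfr v hv]
  · simp only [FrugalGame.sweep, dif_neg hv]
    exact G.averageAt_le hT hv

/-- The invariant of value iteration from `k + 1`. -/
structure FrugalParityGame.Descends (G : FrugalParityGame V) (T : V → Budget) : Prop where
  le : ∀ v, T v ≤ plain (G.k + 1)
  target : ∀ s ∈ G.S, T s = G.fr s
  sweep_le : G.sweep T ≤ T
  enforces : ∃ σ, G.Enforces T σ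

theorem FrugalParityGame.descends_initial {G : FrugalParityGame V}
    (hfr : ∀ s ∈ G.S, G.fr s ≤ plain (G.k + 1)) :
    G.Descends (G.initial (plain (G.k + 1))) := by
  have hle : ∀ v, G.initial (plain (G.k + 1)) v ≤ plain (G.k + 1) := by
    intro v
    unfold FrugalGame.initial
    split_ifs with hv
    · exact hfr v hv
    · exact le_rfl
  refine ⟨hle, fun s hs => if_pos hs, fun v => ?_, G.enforces_initial⟩
  by_cases hv : v ∈ G.S
  · simp only [FrugalGame.sweep, FrugalGame.initial, dif_pos hv, if_pos hv, le_refl]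
  · simp only [FrugalGame.sweep, dif_neg hv]
    rw [FrugalGame.initial, if_neg hv]
    exact G.averageAt_le hle hv

theorem FrugalParityGame.Descends.sweep {G : FrugalParityGame V} {T : V → Budget}
    (h : G.Descends T) : G.Descends (G.sweep T) := by
  have hS : ∀ s ∈ G.S, G.sweep T s = G.fr s := fun s hs => dif_pos hs
  obtain ⟨σ, hσ⟩ := h.enforces
  exact ⟨fun v => (h.sweep_le v).trans (h.le v), hS, G.sweep_mono h.sweep_le,
    hσ.improve h.sweep_le (fun s hs => (hS s hs).trans (h.target s hs).symm)
      fun v hv => by simp only [FrugalGame.sweep, dif_neg hv, le_refl]⟩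

omit [Fintype V] [DecidableEq V] in
theorem sum_lt_of_ne {s : Finset V} {T U : V → Budget} (hle : ∀ v ∈ s, T v ≤ U v)
    (hne : ∃ v ∈ s, U v ≠ T v) : ∑ v ∈ s, T v < ∑ v ∈ s, U v := by
  obtain ⟨v, hv, hne⟩ := hne
  exact Finset.sum_lt_sum hle ⟨v, hv, lt_of_le_of_ne (hle v hv) hne.symm⟩

theorem FrugalParityGame.Descends.sum_lt {G : FrugalParityGame V} {T : V → Budget}
    (h : G.Descends T) (hne : G.sweep T ≠ T) : ∑ v ∈ G.Sᶜ, G.sweep T v < ∑ v ∈ G.Sᶜ, T v := by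
  refine sum_lt_of_ne (fun v _ => h.sweep_le v) ?_
  by_contra! hcon
  refine hne (funext fun v => ?_)
  by_cases hv : v ∈ G.S
  · rw [h.target v hv]
    exact dif_pos hv
  · exact (hcon v (Finset.mem_compl.2 hv)).symm

/-- Player 1's side is in the invariant. For Player 2, the fixed point makes his complementary
budgets equal to their averages, and his index `m + 1` is odd, so staying at them forever wins. -/
theorem FrugalParityGame.Descends.solves {G : FrugalParityGame V} {T : V → Budget}
    (h : G.Descends T) (hT : G.sweep T = T) {m : ℕ} (hm : Even m) (hp : ∀ v ∉ G.S, G.p v = m) :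
    G.Solves T := by
  have havg : ∀ v (hv : v ∉ G.S), T v = G.averageAt T v hv := by
    intro v hv
    conv_lhs => rw [← hT]
    simp only [FrugalGame.sweep, dif_neg hv]
  refine ⟨h.enforces, G.dual.enforces_of_odd (m := m + 1) hm.add_one
    (fun v hv => congrArg (· + 1) (hp v hv)) (fun v hv => ?_) (fun v hv => ?_),
    h.le, h.target, havg⟩
  · exact congrArg (plain (G.k + 1) - ·) (h.target v hv).symm
  · rw [G.averageAt_dual h.le hv, ← havg v hv]
    rfl

/-- Value iteration solves the games with at most one parity index. -/
theorem FrugalParityGame.solve_single (G : FrugalParityGame V)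
    (hfr : ∀ s ∈ G.S, G.fr s ≤ plain (G.k + 1)) {m : ℕ} (hp : ∀ v ∉ G.S, G.p v = m) :
    ∃ T t, (if Odd m then G.frugalSafety else G.frugalReachability).HaltsWith T t ∧ G.Solves T ∧
      t ≤ G.Sᶜ.card * plain (G.k + 1) + 2 := by
  by_cases hm : Odd m
  · have hfr' : ∀ s ∈ G.dual.S, G.dual.fr s ≤ plain (G.dual.k + 1) := fun s _ => G.compl_le _ s
    have e0 : G.compl (G.initial 0) = G.dual.initial (plain (G.dual.k + 1)) := by
      funext v
      by_cases hv : v ∈ G.S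
      · have hv' : v ∈ G.dual.S := hv
        simp only [FrugalGame.compl, FrugalGame.initial, if_pos hv, if_pos hv']
        rfl
      · have hv' : v ∉ G.dual.S := hv
        simp only [FrugalGame.compl, FrugalGame.initial, if_neg hv, if_neg hv']
        rfl
    have hle0 : ∀ v, G.initial 0 v ≤ plain (G.k + 1) := by
      intro v
      unfold FrugalGame.initial
      split_ifs with hv
      · exact hfr v hv
      · exact Nat.zero_le _
    -- Complementing turns this iteration from `0` into the iteration from `k + 1` in the dual game,
    -- so invariant and measure are taken from there.
    obtain ⟨T, t, hT, ⟨⟨hle, hdesc⟩, hfix⟩, ht⟩ := G.iterate_haltsWith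
      (Inv := fun T => (∀ v, T v ≤ plain (G.k + 1)) ∧ G.dual.Descends (G.compl T))
      (μ := fun T => ∑ v ∈ G.Sᶜ, G.compl T v) (T := G.initial 0) (fun T hT hne => by
        have e := G.sweep_dual hT.1
        refine ⟨⟨G.sweep_le hfr hT.1, e ▸ hT.2.sweep⟩, ?_⟩
        rw [← e]
        refine hT.2.sum_lt fun h' => hne ?_
        rw [e] at h'
        rw [← G.compl_compl (G.sweep_le hfr hT.1), h', G.compl_compl hT.1])
      ⟨hle0, e0 ▸ descends_initial hfr'⟩
    refine ⟨T, 1 + t, ?_, ?_, ?_⟩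
    · rw [if_pos hm]
      exact tick_haltsWith.bind hT
    · refine .of_dual hfr hle (hdesc.solves ?_ (m := m + 1) hm.add_one
        fun v hv => congrArg (· + 1) (hp v hv))
      rw [G.sweep_dual hle, hfix]
    · have : ∑ v ∈ G.Sᶜ, G.compl (G.initial 0) v ≤ G.Sᶜ.card * plain (G.k + 1) :=
        Finset.sum_le_card_nsmul _ _ _ fun v _ => G.compl_le _ v
      exact (Nat.add_le_add_left (ht.trans (Nat.succ_le_succ this)) 1).trans_eq (Nat.add_comm _ _)
  · obtain ⟨T, t, hT, ⟨hdesc, hfix⟩, ht⟩ := G.iterate_haltsWith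
      (Inv := G.Descends) (μ := fun T => ∑ v ∈ G.Sᶜ, T v)
      (fun T hT hne => ⟨hT.sweep, hT.sum_lt hne⟩) (descends_initial hfr)
    refine ⟨T, 1 + t, ?_, hdesc.solves hfix (Nat.not_odd_iff_even.1 hm) hp, ?_⟩
    · rw [if_neg hm]
      exact tick_haltsWith.bind hT
    · have : ∑ v ∈ G.Sᶜ, G.initial (plain (G.k + 1)) v ≤ G.Sᶜ.card * plain (G.k + 1) :=
        Finset.sum_le_card_nsmul _ _ _ fun v _ => (descends_initial hfr).le v
      exact (Nat.add_le_add_left (ht.trans (Nat.succ_le_succ this)) 1).trans_eq (Nat.add_comm _ _)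

end ValueIteration

/-! ### The fixed-point loop over the top vertices -/

section FixedPoint

variable {V : Type*} [Fintype V] [DecidableEq V]

namespace FrugalParityGame

/-- The game `subTop`, with the parity indices of `G`. -/
def subTopParity (G : FrugalParityGame V) (f : V → Budget) : FrugalParityGame V where
  toFrugalGame := G.subTop f
  p := G.p

theorem mem_top {G : FrugalParityGame V} {v : V} :
    v ∈ G.top ↔ v ∉ G.S ∧ ∀ u ∉ G.S, G.p u ≤ G.p v := by
  simp only [top, Finset.mem_filter, Finset.mem_compl, and_congr_right_iff]
  intro hv
  have hle : ∀ u ∉ G.S, G.p u ≤ G.maxIndex := fun u hu =>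
    Finset.le_sup (f := id) (Finset.mem_image_of_mem G.p (Finset.mem_compl.2 hu))
  refine ⟨fun e u hu => e ▸ hle u hu, fun h => le_antisymm (hle v hv) (Finset.sup_le fun a ha => ?_)⟩
  obtain ⟨u, hu, rfl⟩ := Finset.mem_image.1 ha
  exact h u (Finset.mem_compl.1 hu)

theorem p_eq_maxIndex {G : FrugalParityGame V} {v : V} (hv : v ∈ G.top) : G.p v = G.maxIndex :=
  (Finset.mem_filter.1 hv).2

theorem top_dual (G : FrugalParityGame V) : G.dual.top = G.top := by
  ext v
  rw [mem_top, mem_top]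
  refine and_congr Iff.rfl (forall_congr' fun u => forall_congr' fun _ => ?_)
  exact Nat.add_le_add_iff_right

theorem ext_of_fields {G H : FrugalParityGame V} (hk : G.k = H.k) (hE : G.E = H.E)
    (hS : G.S = H.S) (hfr : G.fr = H.fr) (hp : G.p = H.p) : G = H := by
  obtain ⟨⟨k, E, S, fr, hex⟩, p⟩ := G
  obtain ⟨⟨k', E', S', fr', hex'⟩, p'⟩ := H
  simp only at hk hE hS hfr hp
  subst hk hE hS hfr hp
  rfl

theorem subParity_dual (G : FrugalParityGame V) (f : V → Budget) :
    (G.subParity f).dual = G.dual.subParity (G.compl f) := by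
  refine ext_of_fields rfl ?_ ?_ (funext fun v => ?_) rfl
  · simp only [subParity, top_dual]
    simp only [dual]
  · simp only [subParity, dual]
    exact congrArg _ G.top_dual.symm
  · exact apply_ite (plain (G.k + 1) - ·) _ _ _

theorem subTopParity_dual (G : FrugalParityGame V) (f : V → Budget) :
    (G.subTopParity f).dual = G.dual.subTopParity (G.compl f) := by
  refine ext_of_fields rfl ?_ ?_ (funext fun v => ?_) rfl
  · simp only [subTopParity, subTop, top_dual]
    simp only [dual]
  · exact congrArg (fun s : Finset V => sᶜ) G.top_dual.symm
  · exact apply_ite (plain (G.k + 1) - ·) _ _ _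

theorem subParity_truncates (G : FrugalParityGame V) (f : V → Budget) :
    (G.subParity f).Truncates G where
  budget := rfl
  sinks := Finset.subset_union_left
  nbrs v hv := by
    simp only [subParity, Finset.mem_union, not_or] at hv
    simp [FrugalGame.nbrs, subParity, hv.2]
  target v hv := if_pos hv
  index _ _ := rfl

theorem subTopParity_truncates (G : FrugalParityGame V) (f : V → Budget) :
    (G.subTopParity f).Truncates G where
  budget := rfl
  sinks v hv := Finset.mem_compl.2 fun h => (mem_top.1 h).1 hv
  nbrs v hv := by
    simp only [subTopParity, subTop, Finset.mem_compl, not_not] at hv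
    simp [FrugalGame.nbrs, subTopParity, subTop, hv]
  target v hv := if_pos hv
  index _ _ := rfl

theorem Truncates.averageAt {H G : FrugalParityGame V} (h : H.Truncates G) (T : V → Budget) {v : V}
    (hH : v ∉ H.S) (hG : v ∉ G.S) : H.averageAt T v hH = G.averageAt T v hG := by
  simp only [FrugalGame.averageAt, h.nbrs v hH]

/-- One round of the fixed-point algorithm, from `f` to `R`. -/
structure IsRound (G : FrugalParityGame V) (f A R : V → Budget) : Prop where
  parity : (G.subParity f).Solves A
  top : (G.subTopParity A).Solves R

namespace IsRound

variable {G : FrugalParityGame V} {f A R : V → Budget}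

theorem parity_top (h : G.IsRound f A R) {v : V} (hv : v ∈ G.top) : A v = f v :=
  (h.parity.average.2.1 v (Finset.mem_union_right _ hv)).trans (if_neg (mem_top.1 hv).1)

theorem parity_sink (h : G.IsRound f A R) {v : V} (hv : v ∈ G.S) : A v = G.fr v :=
  (h.parity.average.2.1 v (Finset.mem_union_left _ hv)).trans (if_pos hv)

theorem top_of_notMem (h : G.IsRound f A R) {v : V} (hv : v ∉ G.top) : R v = A v := by
  refine (h.top.average.2.1 v (Finset.mem_compl.2 hv)).trans ?_
  by_cases hS : v ∈ G.S
  · exact (if_pos hS).trans (h.parity_sink hS).symm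
  · exact if_neg hS

theorem dual (hfr : ∀ s ∈ G.S, G.fr s ≤ plain (G.k + 1)) (hf : ∀ v, f v ≤ plain (G.k + 1))
    (h : G.IsRound f A R) : G.dual.IsRound (G.compl f) (G.compl A) (G.compl R) where
  parity := by
    rw [← subParity_dual]
    refine h.parity.dual fun s _ => ?_
    simp only [subParity]
    split_ifs with hs
    · exact hfr s hs
    · exact hf s
  top := by
    rw [← subTopParity_dual]
    refine h.top.dual fun s _ => ?_
    simp only [subTopParity, subTop]
    split_ifs with hs
    · exact hfr s hs
    · exact h.parity.average.1 s

theorem mono_parity {f' A' R' : V → Budget} (h : G.IsRound f A R) (h' : G.IsRound f' A' R')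
    (hf : ∀ v ∈ G.top, f' v ≤ f v) : A' ≤ A := by
  refine Solves.mono (G := G.subParity f) (H := G.subParity f') rfl rfl rfl rfl (fun s hs => ?_) h.parity h'.parity
  simp only [subParity] at hs ⊢
  split_ifs with hS
  · exact le_rfl
  · exact hf s ((Finset.mem_union.1 hs).resolve_left hS)

theorem mono {f' A' R' : V → Budget} (h : G.IsRound f A R) (h' : G.IsRound f' A' R')
    (hf : ∀ v ∈ G.top, f' v ≤ f v) : R' ≤ R := by
  have hA := h.mono_parity h' hf
  refine Solves.mono (G := G.subTopParity A) (H := G.subTopParity A') rfl rfl rfl rfl (fun s hs => ?_) h.top h'.top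
  simp only [subTopParity, subTop]
  split_ifs with hS
  · exact le_rfl
  · exact hA s

/-- Play in `G_i`; a top vertex is reached with at least `f = X` there, which is enough to switch to
the strategy for `X`. -/
theorem enforces_parity (h : G.IsRound f A R) {X : V → Budget} {σ : Config V → Action V}
    (hX : G.Enforces X σ) (hAX : A ≤ X) (hfX : ∀ v ∈ G.top, X v = f v) :
    ∃ τ, G.Enforces A τ := by
  obtain ⟨τ, hτ⟩ := h.parity.enforces
  refine (G.subParity_truncates f).compose hX hτ hAX fun v hv hS => ?_
  have hv := (Finset.mem_union.1 hv).resolve_left hS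
  rw [hfX v hv, h.parity_top hv]

/-- Play in `R_i` until the top is left; there `R` and `A` agree, so the strategy for `A` takes
over. The hypothesis on the top gives `R ≤ A`. -/
theorem enforces_top (h : G.IsRound f A R) {σ : Config V → Action V}
    (hA : G.Enforces A σ) (hR : ∀ v ∈ G.top, R v ≤ f v) : ∃ τ, G.Enforces R τ := by
  obtain ⟨τ, hτ⟩ := h.top.enforces
  refine (G.subTopParity_truncates A).compose hA hτ (fun v => ?_) fun v hv _ => ?_
  · by_cases hv : v ∈ G.top
    · rw [h.parity_top hv]
      exact hR v hv
    · rw [h.top_of_notMem hv]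
  · rw [h.top_of_notMem (Finset.mem_compl.1 hv)]

/-- At a fixed point `R = A`, so one function has the averages of `G_i` off the top and those of
`R_i` on it. This lets Player 2 cross the top without loss, as `recur` requires. -/
theorem solves (h : G.IsRound f A R) (hm : ∀ v ∈ G.top, Even (G.p v))
    (hA : ∃ τ, G.Enforces A τ) (hfix : ∀ v ∈ G.top, f v = R v) : G.Solves A := by
  have e : R = A := by
    funext v
    by_cases hv : v ∈ G.top
    · rw [← hfix v hv, h.parity_top hv]
    · exact h.top_of_notMem hv
  have hAavg : G.AverageProperty A := by
    refine ⟨h.parity.average.1, fun s hs => h.parity_sink hs, fun v hv => ?_⟩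
    by_cases ht : v ∈ G.top
    · have hv' : v ∉ (G.subTopParity A).S := by simpa [subTopParity, subTop] using ht
      have := h.top.average.2.2 v hv'
      rw [(G.subTopParity_truncates A).averageAt R hv' hv, e] at this
      exact this
    · have hv' : v ∉ (G.subParity f).S := by simp [subParity, hv, ht]
      have := h.parity.average.2.2 v hv'
      rw [(G.subParity_truncates f).averageAt A hv' hv] at this
      exact this
  refine ⟨hA, ?_, hAavg⟩
  obtain ⟨τ, hτ⟩ := h.parity.enforces_dual
  rw [subParity_dual] at hτ
  have htr := G.dual.subParity_truncates (G.compl f)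
  have htop : ∀ v ∈ (G.dual.subParity (G.compl f)).S, v ∉ G.S → v ∈ G.top := by
    intro v hv hS
    have := (Finset.mem_union.1 hv).resolve_left hS
    rwa [top_dual] at this
  by_cases hne : G.top.Nonempty
  · obtain ⟨x, hx⟩ := hne
    refine htr.recur (m := G.p x + 1) (hm x hx).add_one
      (fun v hv => Nat.succ_le_succ ((mem_top.1 hx).2 v hv)) (fun v hv hS => ?_)
      (fun v hv => (congrArg (plain (G.k + 1) - ·) (h.parity_sink hv)).ge)
      (fun v hv _ => ?_) hτ
    · change G.p v + 1 = G.p x + 1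
      rw [p_eq_maxIndex (htop v hv hS), p_eq_maxIndex hx]
    · rw [G.averageAt_dual hAavg.1 hv, ← hAavg.2.2 v hv]
      rfl
  -- With an empty top any odd upper bound on the indices will do.
  · refine htr.recur (m := 2 * ∑ v, G.dual.p v + 1) (odd_two_mul_add_one _) (fun v _ => ?_)
      (fun v hv hS => absurd ⟨v, htop v hv hS⟩ hne)
      (fun v hv => (congrArg (plain (G.k + 1) - ·) (h.parity_sink hv)).ge)
      (fun v hv hv' => absurd ⟨v, htop v hv' hv⟩ hne) hτ
    have := Finset.single_le_sum (f := G.dual.p) (fun _ _ => Nat.zero_le _) (Finset.mem_univ v)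
    omega

end IsRound

/-- The invariant of the fixed-point loop for an even maximal index. -/
structure LoopInv (G : FrugalParityGame V) (R : V → Budget) : Prop where
  round : ∃ f A, G.IsRound f A R ∧ ∀ v ∈ G.top, R v ≤ f v
  enforces : ∃ σ, G.Enforces R σ

theorem LoopInv.le {G : FrugalParityGame V} {R : V → Budget} (h : G.LoopInv R) (v : V) :
    R v ≤ plain (G.k + 1) := by
  obtain ⟨f, A, hr, -⟩ := h.round
  exact hr.top.average.1 v

/-- The budget `k + 1` is unattainable, so the induction starts from a function that is met only at
sinks already won. -/
theorem LoopInv.first {G : FrugalParityGame V} {A R : V → Budget}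
    (h : G.IsRound (fun _ => plain (G.k + 1)) A R) : G.LoopInv R := by
  have hR : ∀ v ∈ G.top, R v ≤ plain (G.k + 1) := fun v _ => h.top.average.1 v
  obtain ⟨σ, hσ⟩ := G.enforces_initial
  have hA : A ≤ G.initial (plain (G.k + 1)) := by
    intro v
    unfold FrugalGame.initial
    split_ifs with hv
    · exact (h.parity_sink hv).le
    · exact h.parity.average.1 v
  obtain ⟨τ, hτ⟩ := h.enforces_parity hσ hA (fun v hv => if_neg (mem_top.1 hv).1)
  exact ⟨⟨_, A, h, hR⟩, h.enforces_top hτ hR⟩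

/-- The previous stage `R` serves as `X`: off the top it equals the previous `A`, which dominates
`A'` by monotonicity. -/
theorem LoopInv.enforces_next {G : FrugalParityGame V} {R A' R' : V → Budget} (h : G.LoopInv R)
    (h' : G.IsRound R A' R') : ∃ σ, G.Enforces A' σ := by
  obtain ⟨⟨f, A, hr, hle⟩, σ, hσ⟩ := h
  refine h'.enforces_parity hσ (fun v => ?_) fun _ _ => rfl
  by_cases hv : v ∈ G.top
  · exact (h'.parity_top hv).le
  · rw [hr.top_of_notMem hv]
    exact hr.mono_parity h' hle v

theorem LoopInv.next_le {G : FrugalParityGame V} {R A' R' : V → Budget} (h : G.LoopInv R)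
    (h' : G.IsRound R A' R') : R' ≤ R := by
  obtain ⟨⟨f, A, hr, hle⟩, -⟩ := h
  exact hr.mono h' hle

theorem LoopInv.next {G : FrugalParityGame V} {R A' R' : V → Budget} (h : G.LoopInv R)
    (h' : G.IsRound R A' R') : G.LoopInv R' := by
  obtain ⟨σ, hσ⟩ := h.enforces_next h'
  have hle : ∀ v ∈ G.top, R' v ≤ R v := fun v _ => h.next_le h' v
  exact ⟨⟨R, A', h', hle⟩, h'.enforces_top hσ hle⟩

theorem LoopInv.sum_lt {G : FrugalParityGame V} {R A' R' : V → Budget} (h : G.LoopInv R)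
    (h' : G.IsRound R A' R') (hne : ∃ v ∈ G.top, R v ≠ R' v) :
    ∑ v ∈ G.top, R' v < ∑ v ∈ G.top, R v :=
  sum_lt_of_ne (fun v _ => h.next_le h' v) hne

theorem solveTop_haltsWith (G : FrugalParityGame V) (hfr : ∀ s ∈ G.S, G.fr s ≤ plain (G.k + 1))
    {A : V → Budget} (hA : ∀ v, A v ≤ plain (G.k + 1)) :
    ∃ R t, (G.solveTop A).HaltsWith R t ∧ (G.subTopParity A).Solves R ∧
      t ≤ G.top.card * plain (G.k + 1) + 3 := by
  have hfrA : ∀ s ∈ (G.subTopParity A).S, (G.subTopParity A).fr s ≤ plain (G.k + 1) := by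
    intro s _
    simp only [subTopParity, subTop]
    split_ifs with hs
    · exact hfr s hs
    · exact hA s
  obtain ⟨R, t, hR, hs, ht⟩ := (G.subTopParity A).solve_single (m := G.maxIndex) hfrA
    (fun v hv => p_eq_maxIndex (by simpa [subTopParity, subTop] using hv))
  refine ⟨R, 1 + t, tick_haltsWith.bind hR, hs, ?_⟩
  have : (G.subTopParity A).Sᶜ = G.top := compl_compl _
  rw [this] at ht
  change t ≤ G.top.card * plain (G.k + 1) + 2 at ht
  omega

/-- Invariant and measure are left abstract, so that an odd largest index can use those of the dual
game while the program itself runs on `G`. -/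
theorem loop_haltsWith (G : FrugalParityGame V) (hfr : ∀ s ∈ G.S, G.fr s ≤ plain (G.k + 1))
    {solve : (V → Budget) → Prog (V → Budget)} {τ : ℕ}
    (hsolve : ∀ f, (∀ v, f v ≤ plain (G.k + 1)) →
      ∃ A t, (solve f).HaltsWith A t ∧ (G.subParity f).Solves A ∧ t ≤ τ)
    {Inv : (V → Budget) → Prop} {μ : (V → Budget) → ℕ}
    (hle : ∀ f, Inv f → ∀ v, f v ≤ plain (G.k + 1))
    (hfix : ∀ f A R, Inv f → G.IsRound f A R → (∀ v ∈ G.top, f v = R v) → G.Solves A)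
    (hnext : ∀ f A R, Inv f → G.IsRound f A R → (∃ v ∈ G.top, f v ≠ R v) → Inv R ∧ μ R < μ f)
    {f : V → Budget} (hf : Inv f) :
    ∃ T t, (G.loop solve f).HaltsWith T t ∧ G.Solves T ∧
      t ≤ (μ f + 1) * (τ + G.top.card * plain (G.k + 1) + 4) := by
  refine Prog.loop_haltsWith (Inv := Inv) (fun f hf => ?_) hf
  obtain ⟨A, t₁, hA, hAs, ht₁⟩ := hsolve f (hle f hf)
  obtain ⟨R, t₂, hR, hRs, ht₂⟩ := G.solveTop_haltsWith hfr hAs.average.1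
  have hr : G.IsRound f A R := ⟨hAs, hRs⟩
  refine ⟨t₁ + (t₂ + (1 + 0)), by omega, ?_⟩
  by_cases h : ∀ v ∈ G.top, f v = R v
  · refine Or.inl ⟨A, hfix f A R hf hr h, hA.bind (hR.bind (tick_haltsWith.bind ?_))⟩
    · have e : (fun v => if v ∈ G.top then f v else A v) = A := by
        funext v
        split_ifs with hv
        · exact (hr.parity_top hv).symm
        · rfl
      simp only [if_pos h, e]
      exact Prog.HaltsWith.pure _
  · obtain ⟨h1, h2⟩ := hnext f A R hf hr (by simpa using h)
    refine Or.inr ⟨R, h1, h2, hA.bind (hR.bind (tick_haltsWith.bind ?_))⟩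
    simp only [if_neg h]
    exact Prog.HaltsWith.pure _

/-- One level of the recursion. -/
theorem threshold_haltsWith (G : FrugalParityGame V) (hfr : ∀ s ∈ G.S, G.fr s ≤ plain (G.k + 1))
    (hcard : ¬ G.indices.card ≤ 1) {τ : ℕ}
    (hsolve : ∀ f, (∀ v, f v ≤ plain (G.k + 1)) →
      ∃ A t, ((G.subParity f).frugalParityThreshold).HaltsWith A t ∧ (G.subParity f).Solves A ∧
        t ≤ τ) :
    ∃ T t, G.frugalParityThreshold.HaltsWith T t ∧ G.Solves T ∧
      t ≤ (G.top.card * plain (G.k + 1) + 2) * (τ + G.top.card * plain (G.k + 1) + 5) := by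
  have hsolve' : ∀ f, (∀ v, f v ≤ plain (G.k + 1)) →
      ∃ A t, (do tick; (G.subParity f).frugalParityThreshold : Prog (V → Budget)).HaltsWith A t ∧
        (G.subParity f).Solves A ∧ t ≤ 1 + τ := by
    intro f hf
    obtain ⟨A, t, h1, h2, h3⟩ := hsolve f hf
    exact ⟨A, 1 + t, tick_haltsWith.bind h1, h2, by omega⟩
  set f₀ : V → Budget := fun _ => if Odd G.maxIndex then 0 else plain (G.k + 1) with hf₀
  have hle₀ : ∀ v, f₀ v ≤ plain (G.k + 1) := by
    intro v
    simp only [hf₀]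
    split_ifs
    · exact Nat.zero_le _
    · exact le_rfl
  obtain ⟨A, t₁, hA, hAs, ht₁⟩ := hsolve f₀ hle₀
  obtain ⟨R, t₂, hR, hRs, ht₂⟩ := G.solveTop_haltsWith hfr hAs.average.1
  have hr : G.IsRound f₀ A R := ⟨hAs, hRs⟩
  have hloop : ∃ T t, (G.loop (fun f => do tick; (G.subParity f).frugalParityThreshold)
      R).HaltsWith T t ∧ G.Solves T ∧ t ≤ (G.top.card * plain (G.k + 1) + 1) *
        (1 + τ + G.top.card * plain (G.k + 1) + 4) := by
    by_cases hm : Odd G.maxIndex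
    · have e₀ : G.compl f₀ = fun _ => plain (G.dual.k + 1) := by
        funext v
        simp only [FrugalGame.compl, hf₀, if_pos hm]
        rfl
      have hm' : ∀ v ∈ G.dual.top, Even (G.dual.p v) := by
        intro v hv
        rw [top_dual] at hv
        change Even (G.p v + 1)
        rw [p_eq_maxIndex hv]
        exact hm.add_one
      have hinv : G.dual.LoopInv (G.compl R) := LoopInv.first (e₀ ▸ hr.dual hfr hle₀)
      obtain ⟨T, t, hT, hs, ht⟩ := G.loop_haltsWith hfr hsolve'
        (Inv := fun f => (∀ v, f v ≤ plain (G.k + 1)) ∧ G.dual.LoopInv (G.compl f))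
        (μ := fun f => ∑ v ∈ G.top, G.compl f v) (fun f hf => hf.1)
        (fun f A R hf hr h => by
          have hr' := hr.dual hfr hf.1
          refine .of_dual hfr hr.parity.average.1 (hr'.solves hm' (hf.2.enforces_next hr') ?_)
          intro v hv
          rw [top_dual] at hv
          exact congrArg (plain (G.k + 1) - ·) (h v hv))
        (fun f A R hf hr h => by
          have hr' := hr.dual hfr hf.1
          have hRle := hr.top.average.1
          refine ⟨⟨hRle, hf.2.next hr'⟩, ?_⟩
          have := hf.2.sum_lt hr'
          rw [top_dual] at this
          refine this ?_
          obtain ⟨v, hv, hne⟩ := h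
          exact ⟨v, hv, fun e => hne ((Nat.sub_sub_self (hf.1 v)).symm.trans
            ((congrArg (plain (G.k + 1) - ·) e).trans (Nat.sub_sub_self (hRle v))))⟩)
        (f := R) ⟨hRs.average.1, hinv⟩
      refine ⟨T, t, hT, hs, ht.trans (Nat.mul_le_mul_right _ (Nat.succ_le_succ ?_))⟩
      exact Finset.sum_le_card_nsmul _ _ _ fun v _ => G.compl_le _ v
    · have e₀ : f₀ = fun _ => plain (G.k + 1) := by
        funext v
        simp only [hf₀, if_neg hm]
      have hm' : ∀ v ∈ G.top, Even (G.p v) := fun v hv =>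
        p_eq_maxIndex hv ▸ Nat.not_odd_iff_even.1 hm
      have hinv : G.LoopInv R := LoopInv.first (e₀ ▸ hr)
      obtain ⟨T, t, hT, hs, ht⟩ := G.loop_haltsWith hfr hsolve'
        (Inv := G.LoopInv) (μ := fun f => ∑ v ∈ G.top, f v) (fun f hf => hf.le)
        (fun f A R hf hr h => hr.solves hm' (hf.enforces_next hr) h)
        (fun f A R hf hr h => ⟨hf.next hr, hf.sum_lt hr h⟩) hinv
      refine ⟨T, t, hT, hs, ht.trans (Nat.mul_le_mul_right _ (Nat.succ_le_succ ?_))⟩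
      exact Finset.sum_le_card_nsmul _ _ _ fun v _ => hinv.le v
  obtain ⟨T, t₃, hT, hs, ht₃⟩ := hloop
  refine ⟨T, 1 + (1 + (t₁ + (t₂ + t₃))), ?_, hs, ?_⟩
  · rw [frugalParityThreshold, dif_neg hcard]
    exact tick_haltsWith.bind (tick_haltsWith.bind (hA.bind (hR.bind hT)))
  -- The opening round, including the two initial ticks, costs no more than the bound `τ + x + 5`
  -- for a loop round; at most `x + 1` loop rounds follow.
  · generalize G.top.card * plain (G.k + 1) = x at *
    nlinarith

end FrugalParityGame

end FixedPoint

/-! ### Solving the recurrence for the running time -/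

section RunningTime

variable {V : Type*} [Fintype V] [DecidableEq V]

/-- The left side is the first three binomial terms, doubled to avoid a fraction. Multiplying by `a
+ b` gives the next case plus a `b ^ 3` term, which is dropped. -/
theorem three_terms_le_add_pow (a b j : ℕ) :
    2 * a ^ (j + 2) + 2 * (j + 2) * b * a ^ (j + 1) + (j + 2) * (j + 1) * b ^ 2 * a ^ j ≤
      2 * (a + b) ^ (j + 2) := by
  induction j with
  | zero => exact le_of_eq (by ring)
  | succ j ih =>
    calc 2 * a ^ (j + 1 + 2) + 2 * (j + 1 + 2) * b * a ^ (j + 1 + 1) +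
          (j + 1 + 2) * (j + 1 + 1) * b ^ 2 * a ^ (j + 1)
        ≤ 2 * a ^ (j + 1 + 2) + 2 * (j + 1 + 2) * b * a ^ (j + 1 + 1) +
          (j + 1 + 2) * (j + 1 + 1) * b ^ 2 * a ^ (j + 1) +
          (j + 2) * (j + 1) * b ^ 3 * a ^ j := Nat.le_add_right _ _
      _ = (a + b) * (2 * a ^ (j + 2) + 2 * (j + 2) * b * a ^ (j + 1) +
          (j + 2) * (j + 1) * b ^ 2 * a ^ j) := by ring
      _ ≤ (a + b) * (2 * (a + b) ^ (j + 2)) := Nat.mul_le_mul_left _ ih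
      _ = 2 * (a + b) ^ (j + 1 + 2) := by ring

/-- The recurrence for the running time, in terms of the numbers `y` and `x` of values to be
computed outside and inside of the top vertices. -/
theorem recurrence_bound {x y j t τ : ℕ} (hx : 1 ≤ x) (hy : j + 1 ≤ y)
    (hτ : τ * (j + 1).factorial ≤ (11 * y) ^ (j + 1)) (ht : t ≤ (4 * x + 2) * (τ + 4 * x + 5)) :
    t * (j + 2).factorial ≤ (11 * (y + x)) ^ (j + 2) := by
  -- Since `1 ≤ x`, the factors satisfy `4 * x + 2 ≤ 6 * x` and `4 * x + 5 ≤ 9 * x`.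
  have h1 : t ≤ 6 * x * τ + 54 * x ^ 2 := ht.trans (by nlinarith)
  have hj : j.factorial ≤ (11 * y) ^ j :=
    (Nat.factorial_le_pow j).trans (Nat.pow_le_pow_left (by omega) j)
  have h2 := three_terms_le_add_pow (11 * y) (11 * x) j
  have h3 : 6 * x * τ * (j + 2).factorial ≤ 6 * x * (j + 2) * (11 * y) ^ (j + 1) := by
    rw [Nat.factorial_succ (j + 1)]
    calc 6 * x * τ * ((j + 1 + 1) * (j + 1).factorial)
        = 6 * x * (j + 2) * (τ * (j + 1).factorial) := by ring
      _ ≤ _ := Nat.mul_le_mul_left _ hτ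
  have h4 : 54 * x ^ 2 * (j + 2).factorial ≤ 54 * x ^ 2 * ((j + 2) * (j + 1)) * (11 * y) ^ j := by
    rw [Nat.factorial_succ (j + 1), Nat.factorial_succ j]
    calc 54 * x ^ 2 * ((j + 1 + 1) * ((j + 1) * j.factorial))
        = 54 * x ^ 2 * ((j + 2) * (j + 1)) * j.factorial := by ring
      _ ≤ _ := Nat.mul_le_mul_left _ hj
  have h5 := Nat.mul_le_mul_right (j + 2).factorial h1
  have e : 11 * (y + x) = 11 * y + 11 * x := by ring
  rw [e]
  generalize (11 * y) ^ (j + 1) = P at *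
  generalize (11 * y) ^ j = Q at *
  generalize (j + 2).factorial = f at *
  -- Comparing doubled coefficients needs `12 ≤ 22` and `108 ≤ 121`; the second is why the base is
  -- 11.
  have h6 : 2 * (j + 2) * (11 * x) * P = 22 * (x * (j + 2) * P) := by ring
  have h7 : (j + 2) * (j + 1) * (11 * x) ^ 2 * Q = 121 * (x ^ 2 * ((j + 2) * (j + 1)) * Q) := by
    ring
  have h8 : 6 * x * (j + 2) * P = 6 * (x * (j + 2) * P) := by ring
  have h9 : 54 * x ^ 2 * ((j + 2) * (j + 1)) * Q = 54 * (x ^ 2 * ((j + 2) * (j + 1)) * Q) := by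
    ring
  rw [add_mul] at h5
  omega

/-- Every factor of `n!` beyond the eleventh is at least 11. This makes the final constant
independent of the number of indices. -/
theorem eleven_pow_le (n : ℕ) : 11 ^ n ≤ 11 ^ 11 * n.factorial := by
  rcases le_total n 11 with h | h
  · exact (Nat.pow_le_pow_right (by norm_num) h).trans (Nat.le_mul_of_pos_right _ n.factorial_pos)
  · calc 11 ^ n = 11 ^ 11 * 11 ^ (n - 11) := by rw [← pow_add, Nat.add_sub_cancel' h]
      _ ≤ 11 ^ 11 * n.factorial := by
        refine Nat.mul_le_mul_left _ (le_trans ?_ (Nat.factorial_mul_pow_sub_le_factorial h))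
        exact Nat.le_mul_of_pos_left _ (Nat.factorial_pos 11)

namespace FrugalParityGame

theorem exists_mem_top {G : FrugalParityGame V} (h : G.indices.Nonempty) : ∃ v, v ∈ G.top := by
  obtain ⟨m, hm, e⟩ := Finset.exists_mem_eq_sup G.indices h id
  obtain ⟨v, hv, rfl⟩ := Finset.mem_image.1 hm
  exact ⟨v, Finset.mem_filter.2 ⟨hv, e.symm⟩⟩

theorem indices_subParity (G : FrugalParityGame V) (f : V → Budget) :
    (G.subParity f).indices = G.indices.erase G.maxIndex := by
  ext a
  simp only [indices, subParity, Finset.mem_image, Finset.mem_compl, Finset.mem_union, not_or,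
    Finset.mem_erase]
  constructor
  · rintro ⟨v, ⟨hv, ht⟩, rfl⟩
    exact ⟨fun e => ht (Finset.mem_filter.2 ⟨Finset.mem_compl.2 hv, e⟩), v, hv, rfl⟩
  · rintro ⟨hne, v, hv, rfl⟩
    exact ⟨v, ⟨hv, fun ht => hne (p_eq_maxIndex ht)⟩, rfl⟩

theorem card_indices_subParity {G : FrugalParityGame V} (h : G.indices.Nonempty)
    (f : V → Budget) : (G.subParity f).indices.card + 1 = G.indices.card := by
  rw [indices_subParity]
  refine Finset.card_erase_add_one ?_
  obtain ⟨v, hv⟩ := exists_mem_top h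
  rw [← p_eq_maxIndex hv]
  exact Finset.mem_image_of_mem _ (Finset.mem_filter.1 hv).1

theorem card_indices_le (G : FrugalParityGame V) : G.indices.card ≤ G.Sᶜ.card :=
  Finset.card_image_le

theorem card_compl_subParity (G : FrugalParityGame V) (f : V → Budget) :
    (G.subParity f).Sᶜ.card + G.top.card = G.Sᶜ.card := by
  have e : (G.subParity f).Sᶜ = G.Sᶜ \ G.top := by
    ext v
    simp [subParity]
  rw [e]
  exact Finset.card_sdiff_add_card_eq_card (Finset.filter_subset _ _)

theorem single_haltsWith {G : FrugalParityGame V} (hfr : ∀ s ∈ G.S, G.fr s ≤ plain (G.k + 1))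
    (h : G.indices.card ≤ 1) :
    ∃ T t, G.frugalParityThreshold.HaltsWith T t ∧ G.Solves T ∧
      t ≤ G.Sᶜ.card * plain (G.k + 1) + 3 := by
  have hp : ∀ v ∉ G.S, G.p v = G.maxIndex := by
    intro v hv
    have hmem : G.p v ∈ G.indices := Finset.mem_image_of_mem _ (Finset.mem_compl.2 hv)
    obtain ⟨u, hu⟩ := exists_mem_top ⟨_, hmem⟩
    rw [← p_eq_maxIndex hu]
    exact Finset.card_le_one.1 h _ hmem _ (Finset.mem_image_of_mem _ (Finset.mem_filter.1 hu).1)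
  obtain ⟨T, t, hT, hs, ht⟩ := G.solve_single hfr hp
  refine ⟨T, 1 + t, ?_, hs, by omega⟩
  rw [frugalParityThreshold, dif_pos h]
  exact tick_haltsWith.bind hT

theorem plain_succ_le (k : ℕ) : plain (k + 1) ≤ 4 * max k 1 := by
  simp only [plain, Budget]
  omega

/-- The algorithm terminates with a solution, and its running time is bounded in terms of the number
of non-sinks and of the number of parity indices in use. -/
theorem exists_haltsWith (n : ℕ) (G : FrugalParityGame V)
    (hfr : ∀ s ∈ G.S, G.fr s ≤ plain (G.k + 1)) (hn : G.indices.card = n) :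
    ∃ T t, G.frugalParityThreshold.HaltsWith T t ∧ G.Solves T ∧ (n = 0 → t ≤ 3) ∧
      (n ≠ 0 → t * n.factorial ≤ (11 * (max G.k 1 * G.Sᶜ.card)) ^ n) := by
  induction n generalizing G with
  | zero =>
    obtain ⟨T, t, hT, hs, ht⟩ := single_haltsWith hfr (by omega)
    have hS : G.Sᶜ.card = 0 := by
      rw [indices, Finset.card_eq_zero, Finset.image_eq_empty] at hn
      rw [hn, Finset.card_empty]
    rw [hS, zero_mul] at ht
    exact ⟨T, t, hT, hs, fun _ => ht, fun h => absurd rfl h⟩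
  | succ n ih =>
    -- Using `max k 1` keeps the bound meaningful for `k = 0`, with `plain (k + 1) = 2 * k + 2` at
    -- most four times as large.
    have hK1 : 1 ≤ max G.k 1 := le_max_right _ _
    have hK := plain_succ_le G.k
    have hN := G.card_indices_le
    rcases n with _ | j
    · obtain ⟨T, t, hT, hs, ht⟩ := single_haltsWith hfr (by omega)
      refine ⟨T, t, hT, hs, fun h => absurd h (by omega), fun _ => ?_⟩
      have h1 : 1 ≤ max G.k 1 * G.Sᶜ.card := Nat.mul_pos hK1 (by omega)
      have h2 : G.Sᶜ.card * plain (G.k + 1) ≤ 4 * (max G.k 1 * G.Sᶜ.card) :=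
        (Nat.mul_le_mul_left _ hK).trans_eq (by ring)
      simp only [zero_add, Nat.factorial_one, mul_one, pow_one]
      exact ht.trans (by omega)
    · have hne : G.indices.Nonempty := Finset.card_pos.1 (by omega)
      have hF : 1 ≤ G.top.card := Finset.card_pos.2 (exists_mem_top hne)
      set y := G.Sᶜ.card - G.top.card with hy
      have hyS : ∀ f, (G.subParity f).Sᶜ.card = y := fun f => by
        have := G.card_compl_subParity f
        omega
      have hSy : G.Sᶜ.card = y + G.top.card := by
        have := G.card_compl_subParity (fun _ => 0)
        omega
      have hjy : j + 1 ≤ y := by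
        have h1 := card_indices_subParity hne (fun _ => 0)
        have h2 := (G.subParity fun _ => 0).card_indices_le
        rw [hyS] at h2
        omega
      obtain ⟨T, t, hT, hs, ht⟩ := G.threshold_haltsWith hfr (by omega)
        (τ := (11 * (max G.k 1 * y)) ^ (j + 1) / (j + 1).factorial) (fun f hf => by
          have hfr' : ∀ s ∈ (G.subParity f).S, (G.subParity f).fr s ≤ plain (G.k + 1) := by
            intro s _
            simp only [subParity]
            split_ifs with hs
            · exact hfr s hs
            · exact hf s
          obtain ⟨A, t, hA, hs, -, ht⟩ := ih (G.subParity f) hfr'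
            (by have := card_indices_subParity hne f; omega)
          have ht := ht (by omega)
          rw [hyS] at ht
          exact ⟨A, t, hA, hs, (Nat.le_div_iff_mul_le (Nat.factorial_pos _)).2 ht⟩)
      refine ⟨T, t, hT, hs, fun h => absurd h (by omega), fun _ => ?_⟩
      -- Top and remaining non-sinks add up to all non-sinks, so the recurrence closes with the same
      -- base.
      rw [hSy, mul_add]
      refine recurrence_bound (Nat.mul_pos hK1 hF) (hjy.trans (Nat.le_mul_of_pos_left _ hK1))
        (Nat.div_mul_le_self _ _) (ht.trans ?_)
      have hx : G.top.card * plain (G.k + 1) ≤ 4 * (max G.k 1 * G.top.card) :=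
        (Nat.mul_le_mul_left _ hK).trans_eq (by ring)
      exact Nat.mul_le_mul (by omega) (by omega)

end FrugalParityGame

end RunningTime

end DiscreteBidding

/-! ### The theorem, with the number of indices in use bounded by `d` or `d + 1` -/

theorem mainTheorem2 :
    ∃ C : ℕ, ∀ (V : Type*) [Fintype V] [DecidableEq V] [Nonempty V]
      (G : DiscreteBidding.FrugalParityGame V) (d : ℕ),
      (∀ s ∈ G.S, G.fr s ≤ DiscreteBidding.plain (G.k + 1)) →
      (∀ v, v ∉ G.S → G.p v ≤ d) →
      ∃ (T : V → DiscreteBidding.Budget) (t : ℕ),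
        G.frugalParityThreshold.HaltsWith T t ∧
        G.IsThreshold T ∧
        G.AverageProperty T ∧
        (1 ≤ G.k → (∀ v, v ∉ G.S → 1 ≤ G.p v) → t ≤ C * (Fintype.card V * G.k) ^ d) ∧
        (1 ≤ G.k → t ≤ C * (Fintype.card V * G.k) ^ (d + 1)) := by
  refine ⟨11 ^ 11, fun V _ _ _ G d hfr hd => ?_⟩
  obtain ⟨T, t, hT, hs, h0, h1⟩ := G.exists_haltsWith _ hfr rfl
  have key : 1 ≤ G.k → ∀ e, G.indices.card ≤ e → t ≤ 11 ^ 11 * (Fintype.card V * G.k) ^ e := by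
    intro hk e he
    have hpos : 1 ≤ Fintype.card V * G.k := Nat.mul_pos Fintype.card_pos hk
    by_cases hn : G.indices.card = 0
    · exact (h0 hn).trans ((by norm_num : 3 ≤ 11 ^ 11 * 1).trans
        (Nat.mul_le_mul_left _ (Nat.one_le_pow _ _ hpos)))
    · refine le_trans ?_ (Nat.mul_le_mul_left _ (Nat.pow_le_pow_right hpos he))
      -- Multiplying by the factorial brings in the sharp bound; `eleven_pow_le` then trades `11 ^
      -- n` for `11 ^ 11 * n!`.
      refine Nat.le_of_mul_le_mul_right ((h1 hn).trans ?_) (Nat.factorial_pos G.indices.card)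
      rw [mul_pow, max_eq_left hk]
      calc 11 ^ G.indices.card * (G.k * G.Sᶜ.card) ^ G.indices.card
          ≤ (11 ^ 11 * G.indices.card.factorial) *
            (Fintype.card V * G.k) ^ G.indices.card := by
            refine Nat.mul_le_mul (DiscreteBidding.eleven_pow_le _) (Nat.pow_le_pow_left ?_ _)
            rw [mul_comm]
            exact Nat.mul_le_mul_right _ (Finset.card_le_univ _)
        _ = _ := by ring
  refine ⟨T, t, hT, hs.isThreshold, hs.average, fun hk hp => key hk d ?_, fun hk => key hk _ ?_⟩
  · have hsub : G.indices ⊆ Finset.Icc 1 d := by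
      intro a ha
      obtain ⟨v, hv, rfl⟩ := Finset.mem_image.1 ha
      rw [Finset.mem_compl] at hv
      exact Finset.mem_Icc.2 ⟨hp v hv, hd v hv⟩
    simpa using Finset.card_le_card hsub
  · have hsub : G.indices ⊆ Finset.range (d + 1) := by
      intro a ha
      obtain ⟨v, hv, rfl⟩ := Finset.mem_image.1 ha
      rw [Finset.mem_compl] at hv
      exact Finset.mem_range.2 (Nat.lt_succ_of_le (hd v hv))
    simpa using Finset.card_le_card hsub
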